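/- **Conventions.** A *pair of schemes* $(Y,X)$ consists of quasi-compact and quasi-separated schemes $Y,X$ and an affine, schematically dominant morphism $f:Y\to X$. A morphism of pairs $g:(Y,X)\to(Y',X')$ is a pair of morphisms $g_Y:Y\to Y'$, $g_X:X\to X'$ with $f'\circ g_Y=g_X\circ f$. The relative normalization $\mathrm{Nor}_Y X\to X$ is the relative spectrum of the integral closure of $\mathcal O_X$ in $f_*\mathcal O_Y$; we write $X=\mathrm{Nor}_Y X$ if this morphism is an isomorphism. For a ring $B$ and a subring $A\subseteq B$ let $\mathrm{Spa}(B,A)$ be the set of equivalence classes of valuations $v$ on $B$ (with kernel an arbitrary prime ideal) with $v\le 1$ on $A$. Call $v$ *bounded* if some element of its value group is larger than all $v(b)$, $b\in B$. Let $\mathrm{Val}(B,A)\subseteq\mathrm{Spa}(B,A)$ be the subset of unbounded valuations, with the topology generated by the sets $\{v: v(a)\le v(b)\neq 0\}$, $a,b\in B$. For $b,a_1,\dots,a_n\in B$ generating the unit ideal, the *rational domain* $\{v: v(a_i)\le v(b)\text{ for all }i\}$ is open. There are sheaves of rings $\mathcal O\subseteq\mathcal M$ on $\mathrm{Val}(B,A)$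 with values $\mathcal M=B_b$ and $\mathcal O=\mathrm{Nor}_{B_b}\big(A[\tfrac{a_1}{b},\dots,\tfrac{a_n}{b}]\big)$ (integral closure, in $B_b$, of the subring generated by the image of $A$ and the $a_i/b$) on this rational domain. One has $\mathcal M=\sigma_*\mathcal O_{\mathrm{Spec} B}$, where $\sigma:\mathrm{Spec} B\to \mathrm{Val}(B,A)$ sends a prime $\mathfrak p$ to the trivial valuation on $\kappa(\mathfrak p)$. For a pair of schemes $(Y,X)$ let $\mathfrak X=(Y,X)_{bir}=\mathrm{Val}(Y,X)$, with sheaves $\mathcal O_{\mathfrak X}\subseteq\mathcal M_{\mathfrak X}=\sigma_*\mathcal O_Y$, be obtained by gluing the spaces $\mathrm{Val}(B,A)$ over the affine open subsets $\mathrm{Spec} A\subseteq X$ with preimage $\mathrm{Spec} B\subseteq Y$. A morphism of pair-ringed spaces is a continuous map $h$ together with a morphism $h^\sharp$ of sheaves of rings on the sheaves $\mathcal M$ which maps $\mathcal O$ to $\mathcal O$; it is a *morphism of birational spaces* if it is a morphism of locally ringed spaces with respect to the sheaves $\mathcal O$ (not necessarily with respect to $\mathcal M$). A morphism of pairs of schemes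 $g:(Y,X)\to(Y',X')$ induces a morphism of birational spaces $g_{bir}:\mathfrak X\to\mathfrak X'$: over affine open subsets $\mathrm{Spec} A\subseteq X$ and $\mathrm{Spec} A'\subseteq X'$ with $g_X(\mathrm{Spec} A)\subseteq\mathrm{Spec} A'$ and with induced homomorphism $\varphi:(B',A')\to(B,A)$, it sends $v\in\mathrm{Val}(B,A)$ to $r(v\circ\varphi)$. Here $r(w)$ is the minimal primary specialization of $w$: $r(w)(b)=w(b)$ if $w(b)$ lies in the convex subgroup $c\Gamma_w$ of the value group generated by the values $w(c)\ge 1$, $c\in B'$, and $r(w)(b)=0$ otherwise. On $\mathcal M$ the morphism is given by $g_Y^\sharp:\mathcal O_{Y'}\to g_{Y,*}\mathcal O_Y$. **Theorem (bir is faithful).** Let $(Y,X)$ and $(Y',X')$ be pairs of schemes with $X=\mathrm{Nor}_Y X$ and $X'=\mathrm{Nor}_{Y'}X'$. Let $g_1,g_2:(Y,X)\to(Y',X')$ be morphisms of pairs of schemes. If $g_{1,bir}=g_{2,bir}$ as morphisms of birational spaces $\mathfrak X\to\mathfrak X'$, then $g_1=g_2$. -/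

import Mathlib

universe u

namespace BirationalSpaces

open CategoryTheory TopologicalSpace Opposite AlgebraicGeometry

/-! ### Valuations on rings -/

section Valuations

variable {Γ₀ : Type*} [LinearOrderedCommGroupWithZero Γ₀]

/-- The convex subgroup `cΓ_v` of the value group generated by the values `v b ≥ 1` (as a subset of
the value group with zero). The set of these values is closed under products, so the convex
subgroup consists of the elements lying between `(v b)⁻¹` and `v b` for such a `b`. -/
def convexGen {B : Type*} [CommRing B] (v : Valuation B Γ₀) : Set Γ₀ :=
  {γ | ∃ b : B, 1 ≤ v b ∧ (v b)⁻¹ ≤ γ ∧ γ ≤ v b}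

theorem mem_convexGen_iff {B : Type*} [CommRing B] (v : Valuation B Γ₀) (a : B) :
    v a ∈ convexGen v ↔ ∃ c : B, 1 ≤ v (a * c) := by
  constructor
  · rintro ⟨b, h1, h2, -⟩
    refine ⟨b, ?_⟩
    have hb : 0 < v b := lt_of_lt_of_le zero_lt_one h1
    rw [map_mul]
    calc (1 : Γ₀) = (v b)⁻¹ * v b := (inv_mul_cancel₀ hb.ne').symm
      _ ≤ v a * v b := mul_le_mul_left h2 _
  · rintro ⟨c, hc⟩
    rcases le_total 1 (v a) with h | h
    · exact ⟨a, h, (inv_le_one_of_one_le₀ h).trans h, le_rfl⟩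
    · rw [map_mul] at hc
      have h1 : 1 ≤ v c := hc.trans (by simpa using mul_le_mul_left h (v c))
      have h0 : 0 < v c := lt_of_lt_of_le zero_lt_one h1
      exact ⟨c, h1, (inv_le_iff_one_le_mul₀ h0).2 hc, h.trans h1⟩

open Classical in
/-- The primary specialization of `v` associated with the convex subgroup `cΓ_v`, that is, the
minimal primary specialization of `v`. -/
noncomputable def minimalSpecialization {B : Type*} [CommRing B] (v : Valuation B Γ₀) :
    Valuation B Γ₀ where
  toFun b := if v b ∈ convexGen v then v b else 0
  map_zero' := by simp
  map_one' := by
    have : v 1 ∈ convexGen v := (mem_convexGen_iff v 1).2 ⟨1, by simp⟩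
    rw [if_pos this, map_one]
  map_mul' a b := by
    by_cases hab : v (a * b) ∈ convexGen v
    · obtain ⟨c, hc⟩ := (mem_convexGen_iff v _).1 hab
      rw [if_pos hab, if_pos ((mem_convexGen_iff v a).2 ⟨b * c, by rwa [← mul_assoc]⟩),
        if_pos ((mem_convexGen_iff v b).2 ⟨a * c, by rwa [← mul_assoc, mul_comm b a]⟩), map_mul]
    · rw [if_neg hab]
      by_cases ha : v a ∈ convexGen v
      · by_cases hb : v b ∈ convexGen v
        · obtain ⟨c, hc⟩ := (mem_convexGen_iff v _).1 ha
          obtain ⟨d, hd⟩ := (mem_convexGen_iff v _).1 hb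
          exact absurd ((mem_convexGen_iff v _).2 ⟨c * d, by
            rw [mul_mul_mul_comm, map_mul]; exact one_le_mul hc hd⟩) hab
        · rw [if_neg hb, mul_zero]
      · rw [if_neg ha, zero_mul]
  map_add_le_max' a b := by
    by_cases hab : v (a + b) ∈ convexGen v
    · rw [if_pos hab]
      obtain ⟨c, hc⟩ := (mem_convexGen_iff v _).1 hab
      rw [map_mul] at hc
      rcases le_max_iff.1 (v.map_add a b) with h | h
      · have ha : v a ∈ convexGen v :=
          (mem_convexGen_iff v _).2 ⟨c, hc.trans (by rw [map_mul]; exact mul_le_mul_left h _)⟩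
        exact le_max_of_le_left (by rwa [if_pos ha])
      · have hb : v b ∈ convexGen v :=
          (mem_convexGen_iff v _).2 ⟨c, hc.trans (by rw [map_mul]; exact mul_le_mul_left h _)⟩
        exact le_max_of_le_right (by rwa [if_pos hb])
    · rw [if_neg hab]
      exact zero_le

/-- The valuation spectrum of a ring: its valuations up to equivalence. -/
structure Spv (B : Type*) [CommRing B] where
  /-- The relation `v(a) ≤ v(b)`, which determines the equivalence class of a valuation `v`. -/
  rel : ValuativeRel B

namespace Spv

variable {A B C : Type*} [CommRing A] [CommRing B] [CommRing C]

/-- `v.le a b` means `v(a) ≤ v(b)`. -/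
def le (v : Spv B) (a b : B) : Prop := @ValuativeRel.vle B _ v.rel a b

/-- The value group of `v` (generated by the values of elements of `B`), with zero. -/
abbrev ValueGroup (v : Spv B) := @ValuativeRel.ValueGroupWithZero B _ v.rel

/-- The valuation representing `v`. -/
noncomputable def valuation (v : Spv B) : Valuation B v.ValueGroup :=
  @ValuativeRel.valuation B _ v.rel

/-- The equivalence class of a valuation. -/
def of {Γ₀ : Type*} [LinearOrderedCommGroupWithZero Γ₀] (v : Valuation B Γ₀) : Spv B :=
  ⟨ValuativeRel.ofValuation v⟩

theorem of_le_iff {Γ₀ : Type*} [LinearOrderedCommGroupWithZero Γ₀] (v : Valuation B Γ₀)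
    (a b : B) : (of v).le a b ↔ v a ≤ v b := Iff.rfl

theorem valuation_le_iff (v : Spv B) (a b : B) : v.valuation a ≤ v.valuation b ↔ v.le a b :=
  letI := v.rel
  (Valuation.Compatible.vle_iff_le (v := ValuativeRel.valuation B) a b).symm

/-- `v` is bounded if some element of its value group is larger than all values of `v`. -/
def IsBounded (v : Spv B) : Prop :=
  ∃ γ : v.ValueGroup, γ ≠ 0 ∧ ∀ b : B, v.valuation b < γ

/-- The pull back of a valuation along a ring homomorphism. -/
noncomputable def comap (φ : A →+* B) (v : Spv B) : Spv A := of (v.valuation.comap φ)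

/-- The retraction sending a valuation to its minimal primary specialization. -/
noncomputable def retract (v : Spv B) : Spv B := of (minimalSpecialization v.valuation)

theorem comap_le_iff (φ : A →+* B) (v : Spv B) (a b : A) :
    (v.comap φ).le a b ↔ v.le (φ a) (φ b) := v.valuation_le_iff _ _

theorem ext {v w : Spv B} (h : ∀ a b, v.le a b ↔ w.le a b) : v = w := by
  cases v; cases w
  exact congrArg _ (ValuativeRel.ext (funext fun a => funext fun b => propext (h a b)))

theorem le_trans (v : Spv B) {a b c : B} (h : v.le a b) (h' : v.le b c) : v.le a c :=
  @ValuativeRel.vle_trans B _ v.rel _ _ _ h h'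

theorem le_total (v : Spv B) (a b : B) : v.le a b ∨ v.le b a := @ValuativeRel.vle_total B _ v.rel a b

theorem le_mul (v : Spv B) {a b : B} (h : v.le a b) (c : B) : v.le (a * c) (b * c) :=
  @ValuativeRel.mul_vle_mul_left B _ v.rel _ _ h c

theorem le_rfl (v : Spv B) (a : B) : v.le a a := @ValuativeRel.vle_refl B _ v.rel a

theorem le_add (v : Spv B) {a b c : B} (h : v.le a c) (h' : v.le b c) : v.le (a + b) c :=
  @ValuativeRel.vle_add B _ v.rel _ _ _ h h'

theorem zero_le (v : Spv B) (a : B) : v.le 0 a := @ValuativeRel.zero_vle B _ v.rel a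

theorem le_cancel (v : Spv B) {a b c : B} (hc : ¬ v.le c 0) (h : v.le (a * c) (b * c)) :
    v.le a b := @ValuativeRel.vle_mul_cancel B _ v.rel _ _ _ hc h

theorem not_one_le_zero (v : Spv B) : ¬ v.le 1 0 := @ValuativeRel.not_vle_one_zero B _ v.rel

theorem mul_le_mul (v : Spv B) {a b c d : B} (h : v.le a b) (h' : v.le c d) :
    v.le (a * c) (b * d) :=
  v.le_trans (v.le_mul h c) (by rw [mul_comm b c, mul_comm b d]; exact v.le_mul h' b)

theorem retract_le_iff (v : Spv B) (a b : B) :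
    v.retract.le a b ↔ ((∃ c, v.le 1 (a * c)) → v.le a b) := by
  classical
  have hmem : ∀ a, v.valuation a ∈ convexGen v.valuation ↔ ∃ c, v.le 1 (a * c) := fun a => by
    rw [mem_convexGen_iff]
    exact exists_congr fun c => by rw [← v.valuation_le_iff, map_one]
  change (if v.valuation a ∈ convexGen v.valuation then v.valuation a else 0) ≤
    (if v.valuation b ∈ convexGen v.valuation then v.valuation b else 0) ↔ _
  by_cases ha : v.valuation a ∈ convexGen v.valuation
  · have ha' := (hmem a).1 ha
    rw [if_pos ha]
    by_cases hb : v.valuation b ∈ convexGen v.valuation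
    · rw [if_pos hb, v.valuation_le_iff]
      exact ⟨fun h _ => h, fun h => h ha'⟩
    · rw [if_neg hb]
      obtain ⟨c, hc⟩ := ha'
      refine ⟨fun h _ => (v.valuation_le_iff _ _).1 (h.trans _root_.zero_le), fun h => ?_⟩
      exact absurd ((hmem b).2 ⟨c, v.le_trans hc (v.le_mul (h ⟨c, hc⟩) c)⟩) hb
  · rw [if_neg ha]
    exact ⟨fun _ h => absurd ((hmem a).2 h) ha, fun _ => _root_.zero_le⟩

theorem not_isBounded_iff (v : Spv B) :
    ¬ v.IsBounded ↔ ∀ a, ¬ v.le a 0 → ∃ c, v.le 1 (a * c) := by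
  let := v.rel
  have key : ∀ a : B, v.valuation a = 0 ↔ v.le a 0 := fun a => by
    rw [← v.valuation_le_iff, map_zero, le_zero_iff]
  constructor
  · intro h a ha
    by_contra! hc
    refine h ⟨(v.valuation a)⁻¹, inv_ne_zero (mt (key a).1 ha), fun b => ?_⟩
    have := hc b
    rw [← v.valuation_le_iff, not_le, map_one, map_mul] at this
    have h0 : 0 < v.valuation a := lt_of_le_of_ne _root_.zero_le (Ne.symm (mt (key a).1 ha))
    refine not_le.1 fun h1 => not_le.2 this ?_
    rw [mul_comm]
    exact (inv_le_iff_one_le_mul₀ h0).1 h1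
  · rintro h ⟨γ, h0, hγ⟩
    induction γ using ValuativeRel.ValueGroupWithZero.ind with | mk r s =>
    obtain ⟨c, hc⟩ := h (s : B) s.2
    have h1 : v.valuation (r * c) < _ := hγ (r * c)
    rw [ValuativeRel.ValueGroupWithZero.mk_eq_div] at h1
    rw [← v.valuation_le_iff, map_one, map_mul] at hc
    refine absurd h1 (not_lt.2 ?_)
    have hs : 0 < v.valuation s := lt_of_le_of_ne _root_.zero_le (Ne.symm (mt (key s).1 s.2))
    change v.valuation r / v.valuation s ≤ _
    rw [div_le_iff₀ hs, map_mul, mul_assoc, mul_comm (v.valuation c)]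
    exact le_mul_of_one_le_right _root_.zero_le hc

theorem not_isBounded_retract (v : Spv B) : ¬ v.retract.IsBounded := by
  rw [not_isBounded_iff]
  intro a ha
  simp only [retract_le_iff] at ha ⊢
  push Not at ha
  obtain ⟨⟨c, hc⟩, -⟩ := ha
  exact ⟨c, fun _ => hc⟩

end Spv

/-- `Spa(B, A)`: the `A`-valuations on `B`. -/
def Spa (B : Type*) [CommRing B] (A : Subring B) : Set (Spv B) := {v | ∀ a ∈ A, v.le a 1}

/-- `Val(B, A)`: the unbounded `A`-valuations on `B`. -/
def Val (B : Type*) [CommRing B] (A : Subring B) : Set (Spv B) :=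
  {v | v ∈ Spa B A ∧ ¬ v.IsBounded}

/-- The valuation on `B` induced by the trivial valuation on the residue field of a prime. -/
noncomputable def trivialAt {B : Type*} [CommRing B] (p : Ideal B) [p.IsPrime] : Spv B := by
  classical
  exact .of ((1 : Valuation p.ResidueField (WithZero (Multiplicative ℤ))).comap
    (algebraMap B p.ResidueField))

theorem trivialAt_le_iff {B : Type*} [CommRing B] (p : Ideal B) [p.IsPrime] (a b : B) :
    (trivialAt p).le a b ↔ (b ∈ p → a ∈ p) := by
  classical
  have h : ∀ x, x ∈ p ↔ algebraMap B p.ResidueField x = 0 := fun x => by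
    rw [← RingHom.mem_ker, p.ker_algebraMap_residueField]
  rw [h, h]
  change (1 : Valuation p.ResidueField _) _ ≤ (1 : Valuation p.ResidueField _) _ ↔ _
  rw [Valuation.one_apply_def, Valuation.one_apply_def]
  split_ifs <;> simp_all

end Valuations

section Points

variable {Y X : Scheme.{u}} (f : Y ⟶ X)

/-- The stalk `(f_* 𝒪_Y)_x`. -/
noncomputable abbrev pushStalk (x : X) : CommRingCat.{u} := (f.base _* Y.presheaf).stalk x

/-- The germ in `(f_* 𝒪_Y)_x` of a section of `𝒪_Y` over `f⁻¹(W)`, where `x ∈ W`. -/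
noncomputable def pushGerm (W : X.Opens) (x : X) (hx : x ∈ W) :
    Γ(Y, f ⁻¹ᵁ W) →+* pushStalk f x :=
  ((f.base _* Y.presheaf).germ W x hx).hom

/-- The canonical homomorphism `𝒪_{X, x} → (f_* 𝒪_Y)_x`. -/
noncomputable def stalkToPushStalk (x : X) : X.presheaf.stalk x →+* pushStalk f x :=
  ((TopCat.Presheaf.stalkFunctor CommRingCat x).map f.c).hom

theorem stalkToPushStalk_germ (W : X.Opens) (x : X) (hx : x ∈ W) (a : Γ(X, W)) :
    stalkToPushStalk f x (X.presheaf.germ W x hx a) = pushGerm f W x hx (f.app W a) :=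
  TopCat.Presheaf.stalkFunctor_map_germ_apply W x hx f.c a

theorem pushGerm_res {V W : X.Opens} (i : V ≤ W) (x : X) (hx : x ∈ V) (s : Γ(Y, f ⁻¹ᵁ W)) :
    pushGerm f V x hx (Y.presheaf.map (homOfLE (f.preimage_mono i)).op s) =
      pushGerm f W x (i hx) s :=
  TopCat.Presheaf.germ_res_apply (f.base _* Y.presheaf) (homOfLE i) x hx s

theorem exists_pushGerm_eq (x : X) (t : pushStalk f x) :
    ∃ (W : X.Opens) (_ : IsAffineOpen W) (hx : x ∈ W) (s : Γ(Y, f ⁻¹ᵁ W)),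
      pushGerm f W x hx s = t := by
  obtain ⟨W, hx, hW, s, hs⟩ := TopCat.Presheaf.exists_mem_germ_eq_of_isBasis
    X.isBasis_affineOpens (f.base _* Y.presheaf) x t
  exact ⟨W, hW, hx, s, hs⟩

/-- The set `Val(Y, X)` for an affine morphism `f : Y ⟶ X` with `𝒪_X → f_* 𝒪_Y` injective. A point
is given by its center `x : X` and an unbounded valuation `v` on the ring `(f_* 𝒪_Y)_x` (up to
equivalence) such that `v ≤ 1` on `𝒪_{X, x}` and `v < 1` on the maximal ideal of `𝒪_{X, x}`.
For affine `Y = Spec B` and `X = Spec A` this is the set of unbounded `A`-valuations of `B`: every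
`v ∈ Val(B, A)` has a center, the prime ideal `q = {a ∈ A | v(a) < 1}` of `A`. Since `v = 1` on
`A ∖ q`, it extends uniquely, with the same values, to the localization
`B_q = B ⊗_A A_q = (f_* 𝒪_Y)_q`. In general the points are the triples `(y, R, Φ)` where `y` is a
point of `Y`, `R` is a valuation ring of `κ(y)` and `Φ : Spec R ⟶ X` is compatible with
`Spec κ(y) ⟶ Y ⟶ X` and such that `Spec κ(y) ⟶ Y ×[X] Spec R` is a closed immersion. -/
@[ext]
structure ValSpace where
  /-- The center `x` of the valuation. -/
  center : X
  /-- The valuation on `(f_* 𝒪_Y)_x`. -/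
  val : Spv (pushStalk f center)
  mem : val ∈ Val _ (stalkToPushStalk f center).range
  lt_one : ∀ a ∈ IsLocalRing.maximalIdeal (X.presheaf.stalk center),
    ¬ val.le 1 (stalkToPushStalk f center a)

namespace ValSpace

variable {f}

/-- The restriction of `v` to a valuation on `Γ(f⁻¹(W), 𝒪_Y)`, where `W` contains the center. -/
noncomputable def on (v : ValSpace f) (W : X.Opens) (hW : v.center ∈ W) : Spv Γ(Y, f ⁻¹ᵁ W) :=
  v.val.comap (pushGerm f W v.center hW)

theorem on_le_iff (v : ValSpace f) (W : X.Opens) (hW : v.center ∈ W) (a b : Γ(Y, f ⁻¹ᵁ W)) :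
    (v.on W hW).le a b ↔ v.val.le (pushGerm f W _ hW a) (pushGerm f W _ hW b) :=
  Spv.comap_le_iff _ _ _ _

theorem on_res (v : ValSpace f) {V W : X.Opens} (i : V ≤ W) (hV : v.center ∈ V)
    (a b : Γ(Y, f ⁻¹ᵁ W)) :
    (v.on V hV).le (Y.presheaf.map (homOfLE (f.preimage_mono i)).op a)
      (Y.presheaf.map (homOfLE (f.preimage_mono i)).op b) ↔ (v.on W (i hV)).le a b := by
  rw [on_le_iff, on_le_iff, pushGerm_res, pushGerm_res]

theorem eq_of_le_iff {v w : ValSpace f} (hc : v.center = w.center)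
    (h : ∀ (W : X.Opens) (hv : v.center ∈ W) (hw : w.center ∈ W) (a b : Γ(Y, f ⁻¹ᵁ W)),
      (v.on W hv).le a b ↔ (w.on W hw).le a b) : v = w := by
  obtain ⟨x, v, h1, h2⟩ := v
  obtain ⟨y, w, h3, h4⟩ := w
  obtain rfl : x = y := hc
  congr
  refine Spv.ext fun a b => ?_
  obtain ⟨W, -, hx, a, rfl⟩ := exists_pushGerm_eq f x a
  obtain ⟨W', -, hx', b, rfl⟩ := exists_pushGerm_eq f x b
  have := h (W ⊓ W') ⟨hx, hx'⟩ ⟨hx, hx'⟩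
    (Y.presheaf.map (homOfLE (f.preimage_mono inf_le_left)).op a)
    (Y.presheaf.map (homOfLE (f.preimage_mono inf_le_right)).op b)
  have e := ((on_le_iff ⟨x, v, h1, h2⟩ _ _ _ _).symm.trans this).trans
    (on_le_iff ⟨x, w, h3, h4⟩ _ _ _ _)
  rw [← pushGerm_res f (inf_le_left : W ⊓ W' ≤ W) x ⟨hx, hx'⟩,
    ← pushGerm_res f (inf_le_right : W ⊓ W' ≤ W') x ⟨hx, hx'⟩]
  exact e

/-- The set of the `v` with center in `W` and `v(a) ≤ v(b) ≠ 0`. -/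
def basicSet (W : X.Opens) (a b : Γ(Y, f ⁻¹ᵁ W)) : Set (ValSpace f) :=
  {v | ∃ h : v.center ∈ W, (v.on W h).le a b ∧ ¬ (v.on W h).le b 0}

instance : TopologicalSpace (ValSpace f) :=
  .generateFrom {S | ∃ (W : X.Opens) (_ : IsAffineOpen W) (a b : Γ(Y, f ⁻¹ᵁ W)), S = basicSet W a b}

theorem isOpen_basicSet {W : X.Opens} (hW : IsAffineOpen W) (a b : Γ(Y, f ⁻¹ᵁ W)) :
    IsOpen (basicSet W a b) :=
  isOpen_generateFrom_of_mem ⟨W, hW, a, b, rfl⟩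

end ValSpace

/-- The canonical homomorphism `(f_* 𝒪_Y)_{f(y)} → 𝒪_{Y, y}`. -/
noncomputable def pushStalkToStalk (y : Y) : pushStalk f (f y) →+* Y.presheaf.stalk y :=
  (Y.presheaf.stalkPushforward CommRingCat f.base y).hom

theorem pushStalkToStalk_germ (W : X.Opens) (y : Y) (hy : f y ∈ W) (s : Γ(Y, f ⁻¹ᵁ W)) :
    pushStalkToStalk f y (pushGerm f W (f y) hy s) = Y.presheaf.germ (f ⁻¹ᵁ W) y hy s :=
  congr($(TopCat.Presheaf.stalkPushforward_germ CommRingCat f.base Y.presheaf W y hy) s)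

/-- The kernel of `(f_* 𝒪_Y)_{f(y)} → 𝒪_{Y, y} → κ(y)`. -/
noncomputable def primeAt (y : Y) : Ideal (pushStalk f (f y)) :=
  (IsLocalRing.maximalIdeal (Y.presheaf.stalk y)).comap (pushStalkToStalk f y)

instance (y : Y) : (primeAt f y).IsPrime :=
  inferInstanceAs (((IsLocalRing.maximalIdeal (Y.presheaf.stalk y)).comap
    (pushStalkToStalk f y))).IsPrime

theorem one_notMem_primeAt (y : Y) : 1 ∉ primeAt f y :=
  (Ideal.ne_top_iff_one _).1 (Ideal.IsPrime.ne_top inferInstance)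

theorem pushGerm_mem_primeAt_iff (W : X.Opens) (y : Y) (hy : f y ∈ W) (s : Γ(Y, f ⁻¹ᵁ W)) :
    pushGerm f W (f y) hy s ∈ primeAt f y ↔ y ∉ Y.basicOpen s := by
  rw [primeAt, Ideal.mem_comap, pushStalkToStalk_germ, IsLocalRing.mem_maximalIdeal,
    mem_nonunits_iff, Y.mem_basicOpen s y hy]

theorem map_mem_maximalIdeal {Z W : Scheme.{u}} (g : Z ⟶ W) (z : Z) (a : W.presheaf.stalk (g z))
    (ha : a ∈ IsLocalRing.maximalIdeal (W.presheaf.stalk (g z))) :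
    g.stalkMap z a ∈ IsLocalRing.maximalIdeal (Z.presheaf.stalk z) := by
  rw [IsLocalRing.mem_maximalIdeal, mem_nonunits_iff] at ha ⊢
  exact fun h => ha (isUnit_of_map_unit (g.stalkMap z).hom a h)

/-- The map `σ : Y → Val(Y, X)` sending `y` to the trivial valuation on `κ(y)`. -/
noncomputable def sigma (y : Y) : ValSpace f where
  center := f y
  val := trivialAt (primeAt f y)
  mem := by
    refine ⟨fun a _ => ?_, (Spv.not_isBounded_iff _).2 fun a ha => ⟨1, ?_⟩⟩
    · rw [trivialAt_le_iff]
      exact fun h => absurd h (one_notMem_primeAt f y)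
    · rw [trivialAt_le_iff] at ha ⊢
      rw [mul_one]
      exact fun h => absurd (fun _ => h) ha
  lt_one a ha := by
    rw [trivialAt_le_iff]
    refine fun h => one_notMem_primeAt f y (h ?_)
    exact map_mem_maximalIdeal f y a ha

theorem sigma_le_iff (W : X.Opens) (y : Y) (hy : (sigma f y).center ∈ W) (a b : Γ(Y, f ⁻¹ᵁ W)) :
    ((sigma f y).on W hy).le a b ↔ (y ∈ Y.basicOpen a → y ∈ Y.basicOpen b) := by
  have h1 := pushGerm_mem_primeAt_iff f W y hy a
  have h2 := pushGerm_mem_primeAt_iff f W y hy b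
  have h3 : ((sigma f y).on W hy).le a b ↔ _ := (Spv.comap_le_iff _ _ _ _).trans
    (trivialAt_le_iff (primeAt f y) (pushGerm f W (f y) hy a) (pushGerm f W (f y) hy b))
  rw [h3, h1, h2, not_imp_not]

theorem sigma_le_zero_iff (W : X.Opens) (y : Y) (hy : (sigma f y).center ∈ W)
    (a : Γ(Y, f ⁻¹ᵁ W)) : ((sigma f y).on W hy).le a 0 ↔ y ∉ Y.basicOpen a := by
  rw [sigma_le_iff, Scheme.basicOpen_zero]
  rfl

theorem sigma_mem_basicSet_iff (W : X.Opens) (y : Y) (a b : Γ(Y, f ⁻¹ᵁ W)) :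
    sigma f y ∈ ValSpace.basicSet W a b ↔ y ∈ Y.basicOpen b := by
  constructor
  · rintro ⟨h, -, h0⟩
    rwa [sigma_le_zero_iff, not_not] at h0
  · intro h
    have hW : (sigma f y).center ∈ W := Y.basicOpen_le b h
    exact ⟨hW, (sigma_le_iff f W y hW a b).2 fun _ => h, by
      rwa [sigma_le_zero_iff, not_not]⟩

theorem continuous_sigma : Continuous (sigma f) := by
  refine continuous_generateFrom_iff.2 ?_
  rintro _ ⟨W, hW, a, b, rfl⟩
  convert (Y.basicOpen b).2
  ext y
  exact sigma_mem_basicSet_iff f W y a b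

/-- `σ` as a continuous map. -/
noncomputable def sigmaHom : TopCat.of Y ⟶ TopCat.of (ValSpace f) :=
  TopCat.ofHom ⟨sigma f, continuous_sigma f⟩

end Points

section PullBack

variable {Y X Y' X' : Scheme.{u}} {f : Y ⟶ X} {f' : Y' ⟶ X'}

theorem preimage_le (gY : Y ⟶ Y') (gX : X ⟶ X') (comm : gY ≫ f' = f ≫ gX) (W' : X'.Opens) :
    f ⁻¹ᵁ gX ⁻¹ᵁ W' ≤ gY ⁻¹ᵁ f' ⁻¹ᵁ W' := by
  rw [← Scheme.Hom.comp_preimage, ← Scheme.Hom.comp_preimage, comm]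

variable (gY : Y ⟶ Y') (gX : X ⟶ X') (comm : gY ≫ f' = f ≫ gX)

/-- The homomorphism `f'_* 𝒪_{Y'} → g_{X,*} f_* 𝒪_Y` induced by a commutative square. -/
noncomputable def pushMap : f'.base _* Y'.presheaf ⟶ gX.base _* (f.base _* Y.presheaf) where
  app W' := gY.appLE (f' ⁻¹ᵁ W'.unop) (f ⁻¹ᵁ gX ⁻¹ᵁ W'.unop) (preimage_le gY gX comm _)
  naturality U V i := by
    refine (Scheme.Hom.map_appLE gY _ _).trans (Eq.symm ?_)
    exact Scheme.Hom.appLE_map gY _ _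

/-- The homomorphism `(f'_* 𝒪_{Y'})_{g(x)} → (f_* 𝒪_Y)_x` induced by a commutative square. -/
noncomputable def pushStalkMap (x : X) : pushStalk f' (gX x) →+* pushStalk f x :=
  ((TopCat.Presheaf.stalkFunctor CommRingCat (gX x)).map (pushMap gY gX comm) ≫
    TopCat.Presheaf.stalkPushforward CommRingCat gX.base (f.base _* Y.presheaf) x).hom

theorem pushStalkMap_germ (W' : X'.Opens) (W : X.Opens) (h : W ≤ gX ⁻¹ᵁ W') (x : X) (hx : x ∈ W)
    (s : Γ(Y', f' ⁻¹ᵁ W')) :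
    pushStalkMap gY gX comm x (pushGerm f' W' (gX x) (h hx) s) =
      pushGerm f W x hx (gY.appLE (f' ⁻¹ᵁ W') (f ⁻¹ᵁ W)
        ((f.preimage_mono h).trans (preimage_le gY gX comm _)) s) := by
  have hx' : gX x ∈ W' := h hx
  have h1 := TopCat.Presheaf.stalkFunctor_map_germ_apply W' (gX x) hx' (pushMap gY gX comm) s
  have h2 := congr($(TopCat.Presheaf.stalkPushforward_germ CommRingCat gX.base
    (f.base _* Y.presheaf) W' x hx') ((pushMap gY gX comm).app (op W') s))
  refine (congrArg (TopCat.Presheaf.stalkPushforward CommRingCat gX.base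
    (f.base _* Y.presheaf) x) h1).trans (h2.trans ?_)
  refine (pushGerm_res f h x hx _).symm.trans ?_
  refine congrArg _ ?_
  exact congr($(Scheme.Hom.appLE_map gY (preimage_le gY gX comm W')
    (homOfLE (f.preimage_mono h)).op) s)

theorem pushStalkMap_stalkToPushStalk (x : X) (a : X'.presheaf.stalk (gX x)) :
    pushStalkMap gY gX comm x (stalkToPushStalk f' (gX x) a) =
      stalkToPushStalk f x (gX.stalkMap x a) := by
  obtain ⟨W', hx, a, rfl⟩ := X'.presheaf.exists_germ_eq a
  rw [stalkToPushStalk_germ, Scheme.Hom.germ_stalkMap_apply]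
  refine (pushStalkMap_germ gY gX comm W' _ le_rfl x hx _).trans
    (Eq.trans (congrArg _ ?_) (stalkToPushStalk_germ f _ x hx _).symm)
  have h : f'.app W' ≫ gY.appLE _ (f ⁻¹ᵁ gX ⁻¹ᵁ W') (preimage_le gY gX comm W') =
      gX.app W' ≫ f.app (gX ⁻¹ᵁ W') := by
    rw [Scheme.Hom.app_eq_appLE f]
    refine (Scheme.Hom.comp_appLE gY f' W' _ (by rw [comm]; exact _root_.le_rfl)).symm.trans ?_
    refine Eq.trans ?_ (Scheme.Hom.comp_appLE f gX W' _ _root_.le_rfl)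
    simp only [comm]
    rfl
  exact congr($h a)

/-- The map `Val(Y, X) → Val(Y', X')` induced by a morphism of pairs: pull back the valuation and
apply the retraction. -/
noncomputable def birFun (v : ValSpace f) : ValSpace f' where
  center := gX v.center
  val := (v.val.comap (pushStalkMap gY gX comm v.center)).retract
  mem := by
    refine ⟨?_, Spv.not_isBounded_retract _⟩
    rintro _ ⟨a, rfl⟩
    rw [Spv.retract_le_iff, Spv.comap_le_iff, pushStalkMap_stalkToPushStalk, map_one]
    exact fun _ => v.mem.1 _ ⟨_, rfl⟩
  lt_one a ha := by
    rw [Spv.retract_le_iff]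
    intro h
    have h1 := h ⟨1, by rw [mul_one]; exact Spv.le_rfl _ _⟩
    rw [Spv.comap_le_iff, pushStalkMap_stalkToPushStalk, map_one] at h1
    exact v.lt_one _ (map_mem_maximalIdeal gX v.center a ha) h1

end PullBack

theorem Spv.retract_comap_le_iff {A B : Type*} [CommRing A] [CommRing B] (φ : A →+* B) (v : Spv B)
    (a b : A) : (v.comap φ).retract.le a b ↔
      ((∃ c, v.le 1 (φ a * φ c)) → v.le (φ a) (φ b)) := by
  simp only [Spv.retract_le_iff, Spv.comap_le_iff, map_mul, map_one]

section PullBack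

variable {Y X Y' X' : Scheme.{u}} {f : Y ⟶ X} {f' : Y' ⟶ X'}

theorem le_preimage (gY : Y ⟶ Y') (gX : X ⟶ X') (comm : gY ≫ f' = f ≫ gX) {W : X.Opens}
    {W' : X'.Opens} (h : W ≤ gX ⁻¹ᵁ W') :
    f ⁻¹ᵁ W ≤ gY ⁻¹ᵁ f' ⁻¹ᵁ W' := (f.preimage_mono h).trans (preimage_le gY gX comm W')

variable (gY : Y ⟶ Y') (gX : X ⟶ X') (comm : gY ≫ f' = f ≫ gX)

/-- The homomorphism `Γ(f'⁻¹(W'), 𝒪_{Y'}) → Γ(f⁻¹(W), 𝒪_Y)` for `W ⊆ g⁻¹(W')`. -/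
noncomputable def pullSec {W : X.Opens} {W' : X'.Opens} (h : W ≤ gX ⁻¹ᵁ W') :
    Γ(Y', f' ⁻¹ᵁ W') →+* Γ(Y, f ⁻¹ᵁ W) :=
  (gY.appLE (f' ⁻¹ᵁ W') (f ⁻¹ᵁ W) (le_preimage gY gX comm h)).hom

variable {W : X.Opens} {W' : X'.Opens} (h : W ≤ gX ⁻¹ᵁ W')

theorem birFun_le_iff (v : ValSpace f) (hv : v.center ∈ W)
    (hv' : (birFun gY gX comm v).center ∈ W') (a b : Γ(Y', f' ⁻¹ᵁ W')) :
    ((birFun gY gX comm v).on W' hv').le a b ↔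
      ((∃ c, v.val.le 1 (pushGerm f W _ hv (pullSec gY gX comm h a) *
        pushStalkMap gY gX comm v.center c)) →
      (v.on W hv).le (pullSec gY gX comm h a) (pullSec gY gX comm h b)) := by
  have hx : gX v.center ∈ W' := hv'
  have ea := pushStalkMap_germ gY gX comm W' W h _ hv a
  have eb := pushStalkMap_germ gY gX comm W' W h _ hv b
  have key := Spv.retract_comap_le_iff (pushStalkMap gY gX comm v.center) v.val
    (pushGerm f' W' _ hx a) (pushGerm f' W' _ hx b)
  rw [ea, eb] at key
  refine (ValSpace.on_le_iff _ _ _ _ _).trans (key.trans ?_)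
  rw [ValSpace.on_le_iff]
  rfl

theorem birFun_le_of_le (v : ValSpace f) (hv : v.center ∈ W)
    (hv' : (birFun gY gX comm v).center ∈ W') {a b : Γ(Y', f' ⁻¹ᵁ W')}
    (hab : (v.on W hv).le (pullSec gY gX comm h a) (pullSec gY gX comm h b)) :
    ((birFun gY gX comm v).on W' hv').le a b :=
  (birFun_le_iff gY gX comm h v hv hv' a b).2 fun _ => hab

theorem le_of_birFun_le (v : ValSpace f) (hv : v.center ∈ W)
    (hv' : (birFun gY gX comm v).center ∈ W') {a b : Γ(Y', f' ⁻¹ᵁ W')}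
    (hab : ((birFun gY gX comm v).on W' hv').le a b)
    (hb : ¬ ((birFun gY gX comm v).on W' hv').le b 0) :
    (v.on W hv).le (pullSec gY gX comm h a) (pullSec gY gX comm h b) := by
  rw [birFun_le_iff gY gX comm h v hv hv'] at hab hb
  push Not at hb
  obtain ⟨⟨c, hc⟩, -⟩ := hb
  rcases (v.on W hv).le_total (pullSec gY gX comm h a) (pullSec gY gX comm h b) with h1 | h1
  · exact h1
  · refine hab ⟨c, v.val.le_trans hc (v.val.le_mul ?_ _)⟩
    rwa [← ValSpace.on_le_iff]

theorem ne_zero_of_birFun (v : ValSpace f) (hv : v.center ∈ W)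
    (hv' : (birFun gY gX comm v).center ∈ W') {b : Γ(Y', f' ⁻¹ᵁ W')}
    (hb : ¬ ((birFun gY gX comm v).on W' hv').le b 0) :
    ¬ (v.on W hv).le (pullSec gY gX comm h b) 0 := fun h0 =>
  hb (birFun_le_of_le gY gX comm h v hv hv' (by rwa [map_zero]))

end PullBack

theorem Spv.ne_zero_of_one_le {B : Type*} [CommRing B] (v : Spv B) {b c : B} (h : v.le 1 (b * c)) :
    ¬ v.le b 0 := fun h0 =>
  v.not_one_le_zero (v.le_trans h (by simpa using v.le_mul h0 c))

theorem exists_affine_le {X : Scheme.{u}} (x : X) (U : X.Opens) (hx : x ∈ U) :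
    ∃ W : X.Opens, IsAffineOpen W ∧ x ∈ W ∧ W ≤ U := by
  obtain ⟨_, ⟨V', hV', rfl⟩, hx, hle⟩ := X.isBasis_affineOpens.exists_subset_of_mem_open hx U.2
  exact ⟨V', hV', hx, hle⟩

theorem ValSpace.exists_one_le {Y X : Scheme.{u}} {f : Y ⟶ X} (v : ValSpace f) {W : X.Opens}
    (hW : v.center ∈ W) {b : Γ(Y, f ⁻¹ᵁ W)} (hb : ¬ (v.on W hW).le b 0) :
    ∃ (V : X.Opens) (_ : IsAffineOpen V) (i : V ≤ W) (hV : v.center ∈ V) (d : Γ(Y, f ⁻¹ᵁ V)),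
      (v.on V hV).le 1 (Y.presheaf.map (homOfLE (f.preimage_mono i)).op b * d) := by
  rw [ValSpace.on_le_iff, map_zero] at hb
  obtain ⟨c, hc⟩ := (Spv.not_isBounded_iff _).1 v.mem.2 _ hb
  obtain ⟨V, -, hV, d, rfl⟩ := exists_pushGerm_eq f _ c
  obtain ⟨V', hV', hx, hle⟩ := exists_affine_le v.center (V ⊓ W) ⟨hV, hW⟩
  refine ⟨V', hV', hle.trans inf_le_right, hx,
    Y.presheaf.map (homOfLE (f.preimage_mono (hle.trans inf_le_left))).op d, ?_⟩
  rw [ValSpace.on_le_iff, map_one, map_mul, pushGerm_res f (hle.trans inf_le_right),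
    pushGerm_res f (hle.trans inf_le_left)]
  exact hc

section PullBack

variable {Y X Y' X' : Scheme.{u}} {f : Y ⟶ X} {f' : Y' ⟶ X'} (gY : Y ⟶ Y') (gX : X ⟶ X')
  (comm : gY ≫ f' = f ≫ gX)

theorem continuous_birFun : Continuous (birFun gY gX comm) := by
  refine continuous_generateFrom_iff.2 ?_
  rintro _ ⟨W', hW', a, b, rfl⟩
  refine isOpen_iff_forall_mem_open.2 fun v hv => ?_
  obtain ⟨hv', hab, hb⟩ := hv
  obtain ⟨V', -, i, hV', d, hd⟩ := (birFun gY gX comm v).exists_one_le hv' hb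
  obtain ⟨W, hW, hx, h⟩ := exists_affine_le v.center (gX ⁻¹ᵁ V') hV'
  set a' := Y'.presheaf.map (homOfLE (f'.preimage_mono i)).op a with ha'
  set b' := Y'.presheaf.map (homOfLE (f'.preimage_mono i)).op b with hb'
  refine ⟨ValSpace.basicSet W (pullSec gY gX comm h (a' * d)) (pullSec gY gX comm h (b' * d)) ∩
    ValSpace.basicSet W 1 (pullSec gY gX comm h (b' * d)), ?_,
    (ValSpace.isOpen_basicSet hW _ _).inter (ValSpace.isOpen_basicSet hW _ _), ?_⟩
  · rintro u ⟨⟨hu, h1, h0⟩, hu2, h2, h02⟩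
    have hu' : (birFun gY gX comm u).center ∈ V' := h hu
    have h1' := birFun_le_of_le gY gX comm h u hu hu' h1
    have h2' := birFun_le_of_le gY gX comm h u hu hu' (a := 1) (b := b' * d)
      (by rw [map_one]; exact h2)
    refine ⟨i hu', ?_, ?_⟩
    · rw [← ValSpace.on_res _ i hu']
      refine Spv.le_cancel _ (c := d) ?_ h1'
      exact Spv.ne_zero_of_one_le _ (c := b') (by rwa [mul_comm])
    · have := Spv.ne_zero_of_one_le _ h2'
      rwa [← map_zero (Y'.presheaf.map (homOfLE (f'.preimage_mono i)).op).hom, hb',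
        ValSpace.on_res _ i hu'] at this
  · have h1 : ((birFun gY gX comm v).on V' hV').le (a' * d) (b' * d) :=
      Spv.le_mul _ ((ValSpace.on_res _ i hV' a b).2 hab) d
    have h0 : ¬ ((birFun gY gX comm v).on V' hV').le (b' * d) 0 :=
      Spv.ne_zero_of_one_le _ (c := 1) (by rwa [mul_one])
    have h0' := ne_zero_of_birFun gY gX comm h v hx hV' h0
    refine ⟨⟨hx, le_of_birFun_le gY gX comm h v hx hV' h1 h0, h0'⟩, hx, ?_, h0'⟩
    have := le_of_birFun_le gY gX comm h v hx hV' hd h0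
    rwa [map_one] at this

/-- `birFun` as a continuous map. -/
noncomputable def birHom : TopCat.of (ValSpace f) ⟶ TopCat.of (ValSpace f') :=
  TopCat.ofHom ⟨birFun gY gX comm, continuous_birFun gY gX comm⟩

theorem birFun_sigma (y : Y) : birFun gY gX comm (sigma f y) = sigma f' (gY y) := by
  refine ValSpace.eq_of_le_iff ?_ ?_
  · change gX (f y) = f' (gY y)
    rw [← Scheme.Hom.comp_apply, ← comm, Scheme.Hom.comp_apply]
  · intro W' hv hw a b
    have hy : (sigma f y).center ∈ gX ⁻¹ᵁ W' := hv
    have key : ∀ s : Γ(Y', f' ⁻¹ᵁ W'), y ∈ Y.basicOpen (pullSec gY gX comm _root_.le_rfl s) ↔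
        gY y ∈ Y'.basicOpen s := fun s => by
      refine (iff_of_eq (congrArg (y ∈ ·) (Scheme.basicOpen_appLE gY _ _ _ s))).trans ?_
      exact ⟨fun h => h.2, fun h => ⟨hy, h⟩⟩
    rw [sigma_le_iff, birFun_le_iff gY gX comm _root_.le_rfl _ hy hv, sigma_le_iff, key, key]
    refine ⟨fun h ha => h ?_ ha, fun h _ => h⟩
    refine ⟨1, ?_⟩
    rw [map_one, mul_one, ← map_one (pushGerm f (gX ⁻¹ᵁ W') (sigma f y).center hy),
      ← ValSpace.on_le_iff, sigma_le_iff, key]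
    exact fun _ => ha

end PullBack

/-! ### Rational domains -/

/-- For `α : A → B` and `ρ : B → L`, the subring of `L` generated by the image of `A` and the
quotients `a / b`, `a ∈ T` (it will be used with `L = B_b`). -/
def quotientRing {A B L : Type*} [CommRing A] [CommRing B] [CommRing L] (α : A →+* B)
    (ρ : B →+* L) (b : B) (T : Set B) : Subring L :=
  Subring.closure (Set.range (ρ.comp α) ∪ {t | ∃ a ∈ T, t * ρ b = ρ a})

theorem isIntegral_map {R S : Type*} [CommRing R] [CommRing S] (φ : R →+* S) (A : Subring R)
    (A' : Subring S) (h : A ≤ A'.comap φ) {s : R} (hs : IsIntegral A s) : IsIntegral A' (φ s) := by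
  obtain ⟨p, hp, hp0⟩ := hs
  refine ⟨p.map (φ.restrict A A' h), hp.map _, ?_⟩
  rw [Polynomial.eval₂_map]
  have : (algebraMap A' S).comp (φ.restrict A A' h) = φ.comp (algebraMap A R) := rfl
  rw [this, ← Polynomial.hom_eval₂, hp0, map_zero]

theorem quotientRing_le_comap {A B L A' B' L' : Type*} [CommRing A] [CommRing B] [CommRing L]
    [CommRing A'] [CommRing B'] [CommRing L'] {α : A →+* B} {ρ : B →+* L} {b : B} {T : Set B}
    {α' : A' →+* B'} {ρ' : B' →+* L'} {b' : B'} {T' : Set B'} (φ : B' →+* B) (ψ : L' →+* L)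
    (k : B) (hα : ∀ a, φ (α' a) ∈ α.range) (hρ : ∀ x, ψ (ρ' x) = ρ (φ x)) (hb : b = φ b' * k)
    (hT : ∀ a ∈ T', φ a * k ∈ T) :
    quotientRing α' ρ' b' T' ≤ (quotientRing α ρ b T).comap ψ := by
  refine Subring.closure_le.2 ?_
  rintro t (⟨a, rfl⟩ | ⟨a, ha, hta⟩)
  · obtain ⟨c, hc⟩ := hα a
    refine Subring.subset_closure (Or.inl ⟨c, ?_⟩)
    rw [RingHom.comp_apply, RingHom.comp_apply, hρ, hc]
  · refine Subring.subset_closure (Or.inr ⟨φ a * k, hT a ha, ?_⟩)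
    rw [hb, map_mul, map_mul, ← hρ, ← hρ, ← hta, map_mul, mul_assoc]

section

variable {Y X : Scheme.{u}} (f : Y ⟶ X)

/-- An affine open `W` of `X` together with finitely many elements `b, a₁, …, aₙ` of
`Γ(f⁻¹(W), 𝒪_Y)` which generate the unit ideal. -/
structure RationalDatum where
  /-- The affine open. -/
  W : X.Opens
  isAffineOpen : IsAffineOpen W
  /-- The denominator. -/
  b : Γ(Y, f ⁻¹ᵁ W)
  /-- The set of the numerators. -/
  T : Set Γ(Y, f ⁻¹ᵁ W)
  finite : T.Finite
  span_eq_top : Ideal.span (insert b T) = ⊤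

theorem map_map_apply (Y : Scheme.{u}) {U V W : Y.Opens} (i : U ≤ V) (j : V ≤ W) (s : Γ(Y, W)) :
    Y.presheaf.map (homOfLE i).op (Y.presheaf.map (homOfLE j).op s) =
      Y.presheaf.map (homOfLE (i.trans j)).op s :=
  congr($(Y.presheaf.map_comp (homOfLE j).op (homOfLE i).op) s).symm

namespace RationalDatum

variable {f} (D : RationalDatum f)

/-- The rational domain of a datum: the `v` with center in `W` and `v(aᵢ) ≤ v(b)` for all `i`. -/
def domain : Set (ValSpace f) :=
  {v | ∃ h : v.center ∈ D.W, ∀ a ∈ D.T, (v.on D.W h).le a D.b}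

/-- The open subset `D(b) ⊆ f⁻¹(W)`. -/
def locus : Y.Opens := Y.basicOpen D.b

theorem locus_le : D.locus ≤ f ⁻¹ᵁ D.W := Y.basicOpen_le D.b

/-- The restriction `Γ(f⁻¹(W), 𝒪_Y) → Γ(D(b), 𝒪_Y)`, that is, `B → B_b`. -/
noncomputable def res : Γ(Y, f ⁻¹ᵁ D.W) →+* Γ(Y, D.locus) :=
  (Y.presheaf.map (homOfLE D.locus_le).op).hom

/-- The subring `A[a₁/b, …, aₙ/b]` of `B_b`. -/
noncomputable def ring : Subring Γ(Y, D.locus) := quotientRing (f.app D.W).hom D.res D.b D.T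

theorem b_ne_zero {v : ValSpace f} (h : v.center ∈ D.W)
    (hT : ∀ a ∈ D.T, (v.on D.W h).le a D.b) : ¬ (v.on D.W h).le D.b 0 := by
  intro h0
  have key : ∀ x ∈ Ideal.span (insert D.b D.T), (v.on D.W h).le x 0 := by
    intro x hx
    induction hx using Submodule.span_induction with
    | mem x hx =>
      rcases hx with rfl | hx
      · exact h0
      · exact Spv.le_trans _ (hT x hx) h0
    | zero => exact Spv.le_rfl _ _
    | add x y _ _ hx hy => exact Spv.le_add _ hx hy
    | smul c x _ hx => simpa [mul_comm] using Spv.le_mul _ hx c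
  exact Spv.not_one_le_zero _ (key 1 (by rw [D.span_eq_top]; trivial))

theorem sigma_mem_domain_iff (y : Y) : sigma f y ∈ D.domain ↔ y ∈ D.locus := by
  constructor
  · rintro ⟨h, hT⟩
    have := D.b_ne_zero h hT
    rwa [sigma_le_zero_iff, not_not] at this
  · intro h
    have hW : (sigma f y).center ∈ D.W := D.locus_le h
    exact ⟨hW, fun a _ => (sigma_le_iff f _ y hW a D.b).2 fun _ => h⟩

theorem isOpen_domain : IsOpen D.domain := by
  have : D.domain = ValSpace.basicSet D.W D.b D.b ∩
      ⋂ a ∈ D.T, ValSpace.basicSet D.W a D.b := by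
    ext v
    simp only [Set.mem_inter_iff, Set.mem_iInter]
    constructor
    · rintro ⟨h, hT⟩
      exact ⟨⟨h, Spv.le_rfl _ _, D.b_ne_zero h hT⟩, fun a ha => ⟨h, hT a ha, D.b_ne_zero h hT⟩⟩
    · rintro ⟨⟨h, -, -⟩, hT⟩
      exact ⟨h, fun a ha => (hT a ha).2.1⟩
  rw [this]
  exact (ValSpace.isOpen_basicSet D.isAffineOpen _ _).inter
    (D.finite.isOpen_biInter fun a _ => ValSpace.isOpen_basicSet D.isAffineOpen _ _)

theorem locus_le_of_domain_subset {U : Opens (ValSpace f)} (h : D.domain ⊆ U) :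
    D.locus ≤ (Opens.map (sigmaHom f)).obj U :=
  fun y hy => h ((D.sigma_mem_domain_iff y).2 hy)

theorem locus_mono {D E : RationalDatum f} (h : D.domain ⊆ E.domain) : D.locus ≤ E.locus :=
  fun y hy => (E.sigma_mem_domain_iff y).1 (h ((D.sigma_mem_domain_iff y).2 hy))

/-- `D` refines `E`: the rational domain of `D` is contained in the one of `E`, and restriction
maps the integral closure of the ring of `E` to the one of `D`. -/
def Refines (D E : RationalDatum f) : Prop :=
  ∃ h : D.domain ⊆ E.domain, E.ring ≤ D.ring.comap
    (Y.presheaf.map (homOfLE (locus_mono h)).op).hom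

theorem Refines.trans {D E F : RationalDatum f} (h : D.Refines E) (h' : E.Refines F) :
    D.Refines F := by
  refine ⟨h.1.trans h'.1, fun t ht => ?_⟩
  have := h.2 (h'.2 ht)
  rw [Subring.mem_comap] at this ⊢
  convert this
  exact congr($(Y.presheaf.map_comp (homOfLE (locus_mono h'.1)).op
    (homOfLE (locus_mono h.1)).op) t)

/-- `D.Integral s` means that the restriction of the section `s` to `D(b)` lies in the integral
closure of `A[a₁/b, …, aₙ/b]` in `B_b`. -/
def Integral {V : Y.Opens} (hV : D.locus ≤ V) (s : Γ(Y, V)) : Prop :=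
  IsIntegral D.ring (Y.presheaf.map (homOfLE hV).op s)

theorem Integral.refine {D E : RationalDatum f} (h : D.Refines E) {V : Y.Opens}
    {hV : E.locus ≤ V} {s : Γ(Y, V)} (hs : E.Integral hV s) :
    D.Integral ((locus_mono h.1).trans hV) s := by
  have := isIntegral_map _ _ _ h.2 hs
  unfold Integral
  convert this
  exact congr($(Y.presheaf.map_comp (homOfLE hV).op (homOfLE (locus_mono h.1)).op) s)

theorem integral_res_iff {V V' : Y.Opens} (i : V' ≤ V) (hV : D.locus ≤ V') (s : Γ(Y, V)) :
    D.Integral hV (Y.presheaf.map (homOfLE i).op s) ↔ D.Integral (hV.trans i) s := by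
  unfold Integral
  rw [← CommRingCat.comp_apply, ← Y.presheaf.map_comp]
  rfl

/-- Restriction of a rational datum to a smaller affine open. -/
noncomputable def restrict {W : X.Opens} (hW : IsAffineOpen W) (i : W ≤ D.W) :
    RationalDatum f where
  W := W
  isAffineOpen := hW
  b := Y.presheaf.map (homOfLE (f.preimage_mono i)).op D.b
  T := Y.presheaf.map (homOfLE (f.preimage_mono i)).op '' D.T
  finite := D.finite.image _
  span_eq_top := by
    rw [← Set.image_insert_eq]
    refine (Ideal.map_span (Y.presheaf.map (homOfLE (f.preimage_mono i)).op).hom _).symm.trans ?_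
    rw [D.span_eq_top, Ideal.map_top]

theorem mem_restrict_iff {W : X.Opens} (hW : IsAffineOpen W) (i : W ≤ D.W) (v : ValSpace f) :
    v ∈ (D.restrict hW i).domain ↔ v.center ∈ W ∧ v ∈ D.domain := by
  constructor
  · rintro ⟨h, hT⟩
    exact ⟨h, i h, fun a ha => (v.on_res i h a D.b).1 (hT _ ⟨a, ha, rfl⟩)⟩
  · rintro ⟨h, h', hT⟩
    refine ⟨h, ?_⟩
    rintro _ ⟨a, ha, rfl⟩
    exact (v.on_res i h a D.b).2 (hT a ha)

theorem restrict_refines {W : X.Opens} (hW : IsAffineOpen W) (i : W ≤ D.W) :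
    (D.restrict hW i).Refines D := by
  refine ⟨fun v hv => ((D.mem_restrict_iff hW i v).1 hv).2, ?_⟩
  refine quotientRing_le_comap (Y.presheaf.map (homOfLE (f.preimage_mono i)).op).hom _ 1 ?_ ?_ ?_ ?_
  · intro a
    exact ⟨X.presheaf.map (homOfLE i).op a, congr($(f.naturality (homOfLE i).op) a)⟩
  · intro x
    exact (map_map_apply Y _ _ x).trans (map_map_apply Y _ _ x).symm
  · exact (mul_one _).symm
  · intro a ha
    rw [mul_one]
    exact ⟨a, ha, rfl⟩

open Pointwise in
/-- The intersection of two rational domains over the same affine open. -/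
noncomputable def prod {W : X.Opens} (hW : IsAffineOpen W) (b b' : Γ(Y, f ⁻¹ᵁ W))
    (T T' : Set Γ(Y, f ⁻¹ᵁ W)) (hT : T.Finite) (hT' : T'.Finite)
    (h : Ideal.span (insert b T) = ⊤) (h' : Ideal.span (insert b' T') = ⊤) :
    RationalDatum f where
  W := W
  isAffineOpen := hW
  b := b * b'
  T := insert b T * insert b' T'
  finite := (hT.insert b).mul (hT'.insert b')
  span_eq_top := by
    rw [Set.insert_eq_of_mem (Set.mul_mem_mul (Set.mem_insert _ _) (Set.mem_insert _ _)),
      ← Ideal.span_mul_span', h, h', Ideal.mul_top]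

open Pointwise in
theorem prod_comm {W : X.Opens} (hW : IsAffineOpen W) (b b' : Γ(Y, f ⁻¹ᵁ W))
    (T T' : Set Γ(Y, f ⁻¹ᵁ W)) (hT : T.Finite) (hT' : T'.Finite)
    (h : Ideal.span (insert b T) = ⊤) (h' : Ideal.span (insert b' T') = ⊤) :
    prod hW b b' T T' hT hT' h h' = prod hW b' b T' T hT' hT h' h := by
  unfold prod
  congr 1
  · exact mul_comm b b'
  · exact mul_comm (insert b T) (insert b' T')

theorem mem_prod {W : X.Opens} (hW : IsAffineOpen W) (b b' : Γ(Y, f ⁻¹ᵁ W))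
    (T T' : Set Γ(Y, f ⁻¹ᵁ W)) (hT : T.Finite) (hT' : T'.Finite)
    (h : Ideal.span (insert b T) = ⊤) (h' : Ideal.span (insert b' T') = ⊤) (v : ValSpace f)
    (hv : v.center ∈ W) (h1 : ∀ a ∈ T, (v.on W hv).le a b) (h2 : ∀ a ∈ T', (v.on W hv).le a b') :
    v ∈ (prod hW b b' T T' hT hT' h h').domain := by
  refine ⟨hv, ?_⟩
  rintro _ ⟨x, hx, y, hy, rfl⟩
  refine Spv.mul_le_mul _ ?_ ?_
  · rcases hx with rfl | hx
    exacts [Spv.le_rfl _ _, h1 x hx]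
  · rcases hy with rfl | hy
    exacts [Spv.le_rfl _ _, h2 y hy]

theorem prod_refines (b' : Γ(Y, f ⁻¹ᵁ D.W)) (T' : Set Γ(Y, f ⁻¹ᵁ D.W)) (hT' : T'.Finite)
    (h' : Ideal.span (insert b' T') = ⊤) :
    (prod D.isAffineOpen D.b b' D.T T' D.finite hT' D.span_eq_top h').Refines D := by
  set F := prod D.isAffineOpen D.b b' D.T T' D.finite hT' D.span_eq_top h' with hF
  refine ⟨?_, ?_⟩
  · rintro v ⟨hv, hT⟩
    refine ⟨hv, fun a ha => ?_⟩
    have h0 := F.b_ne_zero hv hT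
    refine Spv.le_cancel _ (c := b') (fun h => h0 ?_)
      (hT _ (Set.mul_mem_mul (Set.mem_insert_of_mem _ ha) (Set.mem_insert _ _)))
    change (v.on D.W hv).le (D.b * b') 0
    simpa [mul_comm] using Spv.le_mul _ h D.b
  · refine quotientRing_le_comap (RingHom.id _) _ b' ?_ ?_ ?_ ?_
    · exact fun a => ⟨a, rfl⟩
    · exact fun x => map_map_apply Y _ _ x
    · rfl
    · exact fun a ha => Set.mul_mem_mul (Set.mem_insert_of_mem _ ha) (Set.mem_insert _ _)

theorem exists_refines (D E : RationalDatum f) (v : ValSpace f) (hD : v ∈ D.domain)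
    (hE : v ∈ E.domain) : ∃ F : RationalDatum f, v ∈ F.domain ∧ F.Refines D ∧ F.Refines E := by
  obtain ⟨W, hW, hv, hle⟩ := exists_affine_le v.center (D.W ⊓ E.W) ⟨hD.1, hE.1⟩
  have hDE := hle.trans inf_le_right
  have hDD := hle.trans inf_le_left
  let D' := D.restrict hW hDD
  let E' := E.restrict hW hDE
  have hD' : v ∈ D'.domain := (D.mem_restrict_iff hW hDD v).2 ⟨hv, hD⟩
  have hE' : v ∈ E'.domain := (E.mem_restrict_iff hW hDE v).2 ⟨hv, hE⟩
  refine ⟨prod hW D'.b E'.b D'.T E'.T D'.finite E'.finite D'.span_eq_top E'.span_eq_top,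
    mem_prod _ _ _ _ _ _ _ _ _ v hv hD'.2 hE'.2, ?_, ?_⟩
  · exact (D'.prod_refines E'.b E'.T E'.finite E'.span_eq_top).trans (D.restrict_refines hW hDD)
  · refine (congrArg (fun F => Refines F E) (prod_comm hW _ _ _ _ _ _ _ _)).mpr ?_
    exact (E'.prod_refines D'.b D'.T D'.finite D'.span_eq_top).trans (E.restrict_refines hW hDE)

theorem exists_mem_subset (U : Opens (ValSpace f)) (v : ValSpace f) (hv : v ∈ U) :
    ∃ D : RationalDatum f, v ∈ D.domain ∧ D.domain ⊆ U := by
  obtain ⟨U, hU⟩ := U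
  change v ∈ U at hv
  change ∃ D : RationalDatum f, v ∈ D.domain ∧ D.domain ⊆ U
  induction hU with
  | basic S hS =>
    obtain ⟨W, hW, a, b, rfl⟩ := hS
    obtain ⟨hv, hab, hb⟩ := hv
    obtain ⟨V, hV, i, hvV, d, hd⟩ := v.exists_one_le hv hb
    refine ⟨⟨V, hV, Y.presheaf.map (homOfLE (f.preimage_mono i)).op b * d,
      {1, Y.presheaf.map (homOfLE (f.preimage_mono i)).op a * d}, Set.toFinite _,
      (Ideal.eq_top_iff_one _).2 (Ideal.subset_span (by simp))⟩, ⟨hvV, ?_⟩, ?_⟩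
    · rintro _ (rfl | rfl)
      · exact hd
      · exact Spv.le_mul _ ((v.on_res i hvV a b).2 hab) d
    · rintro u ⟨hu, hT⟩
      have h1 := hT 1 (by simp)
      have h2 := hT _ (Set.mem_insert_of_mem _ rfl)
      refine ⟨i hu, ?_, ?_⟩
      · rw [← u.on_res i hu]
        exact Spv.le_cancel _ (Spv.ne_zero_of_one_le _ (by rwa [mul_comm])) h2
      · have := Spv.ne_zero_of_one_le _ h1
        rwa [← map_zero (Y.presheaf.map (homOfLE (f.preimage_mono i)).op).hom,
          u.on_res i hu] at this
  | univ =>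
    obtain ⟨W, hW, hvW, -⟩ := exists_affine_le v.center ⊤ trivial
    exact ⟨⟨W, hW, 1, ∅, Set.finite_empty, (Ideal.eq_top_iff_one _).2
      (Ideal.subset_span (by simp))⟩, ⟨hvW, by simp⟩, Set.subset_univ _⟩
  | inter S T _ _ hS hT =>
    obtain ⟨D, hD, hDS⟩ := hS hv.1
    obtain ⟨E, hE, hET⟩ := hT hv.2
    obtain ⟨F, hF, h1, h2⟩ := exists_refines D E v hD hE
    exact ⟨F, hF, fun u hu => ⟨hDS (h1.1 hu), hET (h2.1 hu)⟩⟩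
  | sUnion S _ ih =>
    obtain ⟨T, hT, hvT⟩ := hv
    obtain ⟨D, hD, hDT⟩ := ih T hT hvT
    exact ⟨D, hD, hDT.trans (Set.subset_sUnion_of_mem hT)⟩

end RationalDatum

end

/-! ### Pair-ringed spaces -/

/-- A pair-ringed space `(𝔛, ℳ, 𝒪)`: a ringed space `(𝔛, ℳ)` with a subsheaf of rings `𝒪 ⊆ ℳ`. -/
structure PairRingedSpace where
  /-- The ringed space `(𝔛, ℳ)`. -/
  M : RingedSpace.{u}
  /-- The subrings `𝒪(U) ⊆ ℳ(U)`. -/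
  integers (U : Opens M) : Subring (M.presheaf.obj (op U))
  res_mem {U V : Opens M} (i : U ≤ V) {s : M.presheaf.obj (op V)} (hs : s ∈ integers V) :
    M.presheaf.map (homOfLE i).op s ∈ integers U
  local_mem {U : Opens M} {s : M.presheaf.obj (op U)}
    (hs : ∀ x ∈ U, ∃ (V : Opens M) (i : V ≤ U), x ∈ V ∧ M.presheaf.map (homOfLE i).op s ∈ integers V) :
    s ∈ integers U

namespace PairRingedSpace

/-- The presheaf of rings `𝒪`. -/
def integerPresheaf (S : PairRingedSpace.{u}) : S.M.carrier.Presheaf CommRingCat.{u} where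
  obj U := .of (S.integers U.unop)
  map {U V} i := CommRingCat.ofHom ((S.M.presheaf.map i).hom.restrict _ _
    fun _ hx => S.res_mem i.unop.le hx)
  map_id U := by
    ext x
    exact congr($(S.M.presheaf.map_id U) (x : S.integers U.unop).1)
  map_comp i j := by
    ext x
    exact congr($(S.M.presheaf.map_comp i j) (x : S.integers _).1)

theorem isSheaf_integerPresheaf (S : PairRingedSpace.{u}) : S.integerPresheaf.IsSheaf := by
  refine (TopCat.Presheaf.isSheaf_iff_isSheafUniqueGluing _).2 fun ι U sf hsf => ?_
  obtain ⟨s, hs, huniq⟩ := S.M.sheaf.existsUnique_gluing U (fun i => (sf i).1)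
    (fun i j => congrArg Subtype.val (hsf i j))
  have hmem : s ∈ S.integers (iSup U) := by
    refine S.local_mem fun x hx => ?_
    obtain ⟨i, hi⟩ := Opens.mem_iSup.1 hx
    refine ⟨U i, le_iSup U i, hi, ?_⟩
    have := hs i
    erw [this]
    exact (sf i).2
  refine ⟨⟨s, hmem⟩, fun i => Subtype.ext (hs i), fun t ht => Subtype.ext ?_⟩
  exact huniq t.1 fun i => congrArg Subtype.val (ht i)

/-- The ringed space `(𝔛, 𝒪)`. -/
def O (S : PairRingedSpace.{u}) : RingedSpace.{u} where
  carrier := S.M.carrier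
  presheaf := S.integerPresheaf
  IsSheaf := S.isSheaf_integerPresheaf

/-- A morphism of pair-ringed spaces: a morphism `(h, h♯)` of the ringed spaces `(𝔛, ℳ)` such that
`h♯` maps `𝒪` into `𝒪`. -/
@[ext]
structure Hom (S T : PairRingedSpace.{u}) where
  /-- The morphism of the ringed spaces `(𝔛, ℳ)`. -/
  hom : S.M ⟶ T.M
  map_mem (U : Opens T.M) (s : T.M.presheaf.obj (op U)) (hs : s ∈ T.integers U) :
    hom.hom.c.app (op U) s ∈ S.integers ((Opens.map hom.hom.base).obj U)

/-- The induced morphism of the ringed spaces `(𝔛, 𝒪)`. -/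
def Hom.homO {S T : PairRingedSpace.{u}} (h : Hom S T) : S.O ⟶ T.O :=
  InducedCategory.homMk
    { base := h.hom.hom.base
      c :=
        { app U := CommRingCat.ofHom ((h.hom.hom.c.app U).hom.restrict _ _ (h.map_mem U.unop))
          naturality U V i := by
            ext x
            exact Subtype.ext congr($(h.hom.hom.c.naturality i) x.1) } }

end PairRingedSpace

/-- A pair-ringed space such that `(𝔛, 𝒪)` is a locally ringed space. -/
structure LocallyPairRingedSpace extends PairRingedSpace.{u} where
  isLocalRing_stalk (x : toPairRingedSpace.O) :
    IsLocalRing (toPairRingedSpace.O.presheaf.stalk x)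

/-- A morphism of birational spaces: a morphism of pair-ringed spaces which is a morphism of
locally ringed spaces with respect to `𝒪` (but not necessarily with respect to `ℳ`). -/
@[ext]
structure LocallyPairRingedSpace.Hom (S T : LocallyPairRingedSpace.{u}) extends
    PairRingedSpace.Hom S.toPairRingedSpace T.toPairRingedSpace where
  isLocalHom_stalkMap (x : S.O) : IsLocalHom (toHom.homO.hom.stalkMap x).hom

section

variable {Y X : Scheme.{u}} (f : Y ⟶ X)

/-- The ringed space `(Val(Y, X), ℳ)` with `ℳ = σ_* 𝒪_Y`; on a rational domain it is `B_b`. -/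
noncomputable def valM : RingedSpace.{u} where
  carrier := TopCat.of (ValSpace f)
  presheaf := sigmaHom f _* Y.presheaf
  IsSheaf := TopCat.Sheaf.pushforward_sheaf_of_sheaf _ Y.sheaf.2

theorem exists_integral_refine {U : Opens (ValSpace f)} {v : ValSpace f} (hv : v ∈ U)
    (D : RationalDatum f) (hD : v ∈ D.domain) :
    ∃ E : RationalDatum f, v ∈ E.domain ∧ E.domain ⊆ U ∧ E.Refines D := by
  obtain ⟨F, hF, hFU⟩ := RationalDatum.exists_mem_subset U v hv
  obtain ⟨E, hE, h1, h2⟩ := RationalDatum.exists_refines F D v hF hD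
  exact ⟨E, hE, h1.1.trans hFU, h2⟩

/-- The sections of `𝒪` over `U`: those sections of `ℳ` which locally, on a rational domain with
ring `B_b`, belong to the integral closure of `A[a₁/b, …, aₙ/b]` in `B_b`. -/
noncomputable def valIntegers (U : Opens (ValSpace f)) :
    Subring Γ(Y, (Opens.map (sigmaHom f)).obj U) where
  carrier := {s | ∀ v ∈ U, ∃ (D : RationalDatum f) (h : D.domain ⊆ U), v ∈ D.domain ∧
    D.Integral (D.locus_le_of_domain_subset h) s}
  mul_mem' {s t} hs ht v hv := by
    obtain ⟨D, hDU, hvD, hD⟩ := hs v hv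
    obtain ⟨E, hEU, hvE, hE⟩ := ht v hv
    obtain ⟨F, hvF, h1, h2⟩ := RationalDatum.exists_refines D E v hvD hvE
    refine ⟨F, h1.1.trans hDU, hvF, ?_⟩
    unfold RationalDatum.Integral
    rw [map_mul]
    exact (hD.refine h1).mul (hE.refine h2)
  add_mem' {s t} hs ht v hv := by
    obtain ⟨D, hDU, hvD, hD⟩ := hs v hv
    obtain ⟨E, hEU, hvE, hE⟩ := ht v hv
    obtain ⟨F, hvF, h1, h2⟩ := RationalDatum.exists_refines D E v hvD hvE
    refine ⟨F, h1.1.trans hDU, hvF, ?_⟩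
    unfold RationalDatum.Integral
    rw [map_add]
    exact (hD.refine h1).add (hE.refine h2)
  one_mem' v hv := by
    obtain ⟨D, hD, hDU⟩ := RationalDatum.exists_mem_subset U v hv
    refine ⟨D, hDU, hD, ?_⟩
    unfold RationalDatum.Integral
    rw [map_one]
    exact isIntegral_one
  zero_mem' v hv := by
    obtain ⟨D, hD, hDU⟩ := RationalDatum.exists_mem_subset U v hv
    refine ⟨D, hDU, hD, ?_⟩
    unfold RationalDatum.Integral
    rw [map_zero]
    exact isIntegral_zero
  neg_mem' {s} hs v hv := by
    obtain ⟨D, hDU, hvD, hD⟩ := hs v hv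
    refine ⟨D, hDU, hvD, ?_⟩
    unfold RationalDatum.Integral
    rw [map_neg]
    exact hD.neg

/-- The pair-ringed space `Val(Y, X)`. -/
noncomputable def valPairRingedSpace : PairRingedSpace.{u} where
  M := valM f
  integers := valIntegers f
  res_mem {U V} i s hs v hv := by
    obtain ⟨D, hDV, hvD, hD⟩ := hs v (i hv)
    obtain ⟨E, hvE, hEU, hED⟩ := exists_integral_refine f hv D hvD
    refine ⟨E, hEU, hvE, ?_⟩
    have := hD.refine hED
    exact (E.integral_res_iff _ _ s).2 this
  local_mem {U s} hs v hv := by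
    obtain ⟨V, i, hvV, h⟩ := hs v hv
    obtain ⟨D, hDV, hvD, hD⟩ := h v hvV
    exact ⟨D, hDV.trans i, hvD, (D.integral_res_iff _ _ s).1 hD⟩

end

section

variable {Y X Y' X' : Scheme.{u}} {f : Y ⟶ X} {f' : Y' ⟶ X'} (gY : Y ⟶ Y') (gX : X ⟶ X')
  (comm : gY ≫ f' = f ≫ gX)

/-- The pull back of a rational datum. -/
noncomputable def RationalDatum.pull (D : RationalDatum f') {W : X.Opens} (hW : IsAffineOpen W)
    (h : W ≤ gX ⁻¹ᵁ D.W) : RationalDatum f where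
  W := W
  isAffineOpen := hW
  b := pullSec gY gX comm h D.b
  T := pullSec gY gX comm h '' D.T
  finite := D.finite.image _
  span_eq_top := by
    rw [← Set.image_insert_eq, ← Ideal.map_span, D.span_eq_top, Ideal.map_top]

theorem RationalDatum.mem_pull_iff (D : RationalDatum f') {W : X.Opens} (hW : IsAffineOpen W)
    (h : W ≤ gX ⁻¹ᵁ D.W) (v : ValSpace f) :
    v ∈ (D.pull gY gX comm hW h).domain ↔ v.center ∈ W ∧ birFun gY gX comm v ∈ D.domain := by
  constructor
  · rintro ⟨hv, hT⟩
    exact ⟨hv, h hv, fun a ha => birFun_le_of_le gY gX comm h v hv (h hv) (hT _ ⟨a, ha, rfl⟩)⟩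
  · rintro ⟨hv, hv', hT⟩
    refine ⟨hv, ?_⟩
    rintro _ ⟨a, ha, rfl⟩
    exact le_of_birFun_le gY gX comm h v hv hv' (hT a ha) (D.b_ne_zero hv' hT)

theorem RationalDatum.pull_locus_le (D : RationalDatum f') {W : X.Opens} (hW : IsAffineOpen W)
    (h : W ≤ gX ⁻¹ᵁ D.W) : (D.pull gY gX comm hW h).locus ≤ gY ⁻¹ᵁ D.locus := by
  refine (Scheme.basicOpen_appLE gY _ _ (le_preimage gY gX comm h) D.b).trans_le inf_le_right

theorem RationalDatum.pull_integral (D : RationalDatum f') {W : X.Opens} (hW : IsAffineOpen W)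
    (h : W ≤ gX ⁻¹ᵁ D.W) {V : Y'.Opens} {hV : D.locus ≤ V} {s : Γ(Y', V)} (hs : D.Integral hV s)
    {V' : Y.Opens} (hV' : V' ≤ gY ⁻¹ᵁ V) (hD : (D.pull gY gX comm hW h).locus ≤ V') :
    (D.pull gY gX comm hW h).Integral hD (gY.appLE V V' hV' s) := by
  set E := D.pull gY gX comm hW h
  have hle : E.locus ≤ gY ⁻¹ᵁ D.locus := D.pull_locus_le gY gX comm hW h
  have key : D.ring ≤ E.ring.comap (gY.appLE D.locus E.locus hle).hom := by
    refine quotientRing_le_comap (pullSec gY gX comm h) _ 1 ?_ ?_ ?_ ?_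
    · intro a
      refine ⟨gX.appLE D.W W h a, ?_⟩
      have e : gX.appLE D.W W h ≫ f.app W = f'.app D.W ≫ gY.appLE (f' ⁻¹ᵁ D.W) (f ⁻¹ᵁ W)
          (le_preimage gY gX comm h) := by
        rw [Scheme.Hom.app_eq_appLE, Scheme.Hom.app_eq_appLE, Scheme.Hom.appLE_comp_appLE,
          Scheme.Hom.appLE_comp_appLE]
        simp only [comm]
      exact congr($e a)
    · intro x
      have e : Y'.presheaf.map (homOfLE D.locus_le).op ≫ gY.appLE D.locus E.locus hle =
          gY.appLE (f' ⁻¹ᵁ D.W) (f ⁻¹ᵁ W) (le_preimage gY gX comm h) ≫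
            Y.presheaf.map (homOfLE E.locus_le).op := by
        exact (Scheme.Hom.map_appLE gY _ _).trans (Scheme.Hom.appLE_map gY _ _).symm
      exact congr($e x)
    · exact (mul_one _).symm
    · intro a ha
      rw [mul_one]
      exact ⟨a, ha, rfl⟩
  have := isIntegral_map _ _ _ key hs
  unfold RationalDatum.Integral
  convert this
  have e : gY.appLE V V' hV' ≫ Y.presheaf.map (homOfLE hD).op =
      Y'.presheaf.map (homOfLE hV).op ≫ gY.appLE D.locus E.locus hle := by
    rw [Scheme.Hom.map_appLE, Scheme.Hom.appLE_map]
  exact congr($e s)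

theorem sigma_preimage_le (U : Opens (ValSpace f')) :
    (Opens.map (sigmaHom f)).obj ((Opens.map (birHom gY gX comm)).obj U) ≤
      gY ⁻¹ᵁ (Opens.map (sigmaHom f')).obj U := by
  intro y hy
  change sigma f' (gY y) ∈ U
  rw [← birFun_sigma gY gX comm]
  exact hy

/-- The morphism `(Val(Y, X), ℳ) → (Val(Y', X'), ℳ)` induced by a morphism of pairs; on sections
it is given by `g_Y`. -/
noncomputable def birM : valM f ⟶ valM f' :=
  InducedCategory.homMk
    { base := birHom gY gX comm
      c :=
        { app U := gY.appLE ((Opens.map (sigmaHom f')).obj U.unop)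
            ((Opens.map (sigmaHom f)).obj ((Opens.map (birHom gY gX comm)).obj U.unop))
            (sigma_preimage_le gY gX comm U.unop)
          naturality U V i := by
            refine (Scheme.Hom.map_appLE gY _ _).trans (Eq.symm ?_)
            exact Scheme.Hom.appLE_map gY _ _ } }

/-- The morphism of pair-ringed spaces `Val(Y, X) → Val(Y', X')`. -/
noncomputable def birPair : PairRingedSpace.Hom (valPairRingedSpace f) (valPairRingedSpace f') where
  hom := birM gY gX comm
  map_mem U s hs v hv := by
    obtain ⟨D, hDU, hvD, hD⟩ := hs (birFun gY gX comm v) hv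
    obtain ⟨W, hW, hvW, h⟩ := exists_affine_le v.center (gX ⁻¹ᵁ D.W) hvD.1
    refine ⟨D.pull gY gX comm hW h, fun u hu => hDU ((D.mem_pull_iff gY gX comm hW h u).1 hu).2,
      (D.mem_pull_iff gY gX comm hW h v).2 ⟨hvW, hvD⟩, ?_⟩
    exact D.pull_integral gY gX comm hW h hD _ _

end

/-! ### The stalks of `𝒪` -/

theorem isIntegral_le_one {R Γ₀ : Type*} [CommRing R] [LinearOrderedCommGroupWithZero Γ₀]
    (w : Valuation R Γ₀) (A : Subring R) (hA : A ≤ w.integer) {s : R} (hs : IsIntegral A s) :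
    w s ≤ 1 :=
  (Valuation.integer.integers w).mem_of_integral (isIntegral_map (RingHom.id R) A w.integer hA hs)

section

variable {Y X : Scheme.{u}} {f : Y ⟶ X}

theorem RationalDatum.exists_refines_le (D E : RationalDatum f) (v : ValSpace f)
    (hD : v ∈ D.domain) (hE : v ∈ E.domain) :
    ∃ F : RationalDatum f, v ∈ F.domain ∧ F.Refines D ∧ F.Refines E ∧ F.W ≤ D.W := by
  obtain ⟨F, hF, h1, h2⟩ := exists_refines D E v hD hE
  obtain ⟨W, hW, hv, hle⟩ := exists_affine_le v.center (D.W ⊓ F.W) ⟨hD.1, hF.1⟩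
  have hr := F.restrict_refines hW (hle.trans inf_le_right)
  exact ⟨F.restrict hW (hle.trans inf_le_right), (F.mem_restrict_iff _ _ v).2 ⟨hv, hF⟩,
    hr.trans h1, hr.trans h2, hle.trans inf_le_left⟩

theorem RationalDatum.exists_valuation [IsAffineHom f] (D : RationalDatum f) {v : ValSpace f}
    (hv : v ∈ D.domain) : ∃ w : Valuation Γ(Y, D.locus) (v.on D.W hv.1).ValueGroup,
      (∀ a b, w (D.res a) ≤ w (D.res b) ↔ (v.on D.W hv.1).le a b) ∧
      ∀ s, IsIntegral D.ring s → w s ≤ 1 := by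
  have hY : IsAffineOpen (f ⁻¹ᵁ D.W) := D.isAffineOpen.preimage f
  let : Algebra Γ(Y, f ⁻¹ᵁ D.W) Γ(Y, D.locus) := D.res.toAlgebra
  have hloc : IsLocalization.Away D.b Γ(Y, D.locus) := hY.isLocalization_basicOpen D.b
  set v₀ := (v.on D.W hv.1).valuation
  have h0 : v₀ D.b ≠ 0 := fun h => D.b_ne_zero hv.1 hv.2
    ((Spv.valuation_le_iff _ _ _).1 (by rw [map_zero]; exact h.le))
  have hS : Submonoid.powers D.b ≤ v₀.supp.primeCompl := by
    rintro _ ⟨n, rfl⟩ h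
    exact pow_ne_zero n h0 ((map_pow v₀ D.b n).symm.trans h)
  let w := v₀.extendToLocalization hS Γ(Y, D.locus)
  have hw : ∀ a, w (D.res a) = v₀ a := fun a =>
    v₀.extendToLocalization_apply_map_apply hS Γ(Y, D.locus) a
  refine ⟨w, fun a b => by rw [hw, hw]; exact Spv.valuation_le_iff _ _ _, fun s hs => ?_⟩
  refine isIntegral_le_one w D.ring (Subring.closure_le.2 ?_) hs
  rintro t (⟨a, rfl⟩ | ⟨a, ha, hta⟩)
  · change w (D.res (f.app D.W a)) ≤ 1
    rw [hw, ← map_one v₀, Spv.valuation_le_iff, ValSpace.on_le_iff, map_one,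
      ← stalkToPushStalk_germ f D.W v.center hv.1 a]
    exact v.mem.1 _ ⟨_, rfl⟩
  · change w t ≤ 1
    have h1 : w t * v₀ D.b = v₀ a := by rw [← hw, ← hw, ← hta, map_mul]
    have h2 : v₀ a ≤ v₀ D.b := (Spv.valuation_le_iff _ _ _).2 (hv.2 a ha)
    rw [← h1] at h2
    exact (mul_le_iff_le_one_left (lt_of_le_of_ne zero_le (Ne.symm h0))).1 h2

theorem RationalDatum.exists_fraction [IsAffineHom f] (D : RationalDatum f) (s : Γ(Y, D.locus)) :
    ∃ (n : ℕ) (t : Γ(Y, f ⁻¹ᵁ D.W)), D.res (D.b ^ n) * s = D.res t := by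
  have hY : IsAffineOpen (f ⁻¹ᵁ D.W) := D.isAffineOpen.preimage f
  let : Algebra Γ(Y, f ⁻¹ᵁ D.W) Γ(Y, D.locus) := D.res.toAlgebra
  have hloc : IsLocalization.Away D.b Γ(Y, D.locus) := hY.isLocalization_basicOpen D.b
  obtain ⟨⟨t, ⟨_, n, rfl⟩⟩, h⟩ := IsLocalization.surj (Submonoid.powers D.b) s
  exact ⟨n, t, by rw [mul_comm]; exact h⟩

theorem RationalDatum.isUnit_res (D : RationalDatum f) : IsUnit (D.res D.b) :=
  Y.toRingedSpace.isUnit_res_basicOpen D.b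

/-- If `v(s) ≥ 1`, then `s` is invertible on a smaller rational domain, with integral inverse. -/
theorem RationalDatum.exists_inverse (D : RationalDatum f) {v : ValSpace f} (hv : v ∈ D.domain)
    (s : Γ(Y, D.locus)) (n : ℕ) (t : Γ(Y, f ⁻¹ᵁ D.W)) (hs : D.res (D.b ^ n) * s = D.res t)
    (h : (v.on D.W hv.1).le (D.b ^ n) t) :
    ∃ (E : RationalDatum f) (h : E.Refines D) (r : Γ(Y, E.locus)), v ∈ E.domain ∧
      IsIntegral E.ring r ∧ Y.presheaf.map (homOfLE (locus_mono h.1)).op s * r = 1 := by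
  have hpow : ¬ (v.on D.W hv.1).le (D.b ^ n) 0 := by
    have h0 := D.b_ne_zero hv.1 hv.2
    rw [← Spv.valuation_le_iff, map_zero, le_zero_iff] at h0 ⊢
    rw [map_pow]
    exact pow_ne_zero n h0
  have ht : ¬ (v.on D.W hv.1).le t 0 := fun h0 => hpow (Spv.le_trans _ h h0)
  obtain ⟨V, hV, i, hvV, d, hd⟩ := v.exists_one_le hv.1 ht
  set ρ := Y.presheaf.map (homOfLE (f.preimage_mono i)).op with hρ
  let E₀ : RationalDatum f := ⟨V, hV, ρ t * d, {1, ρ (D.b ^ n) * d}, Set.toFinite _,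
    (Ideal.eq_top_iff_one _).2 (Ideal.subset_span (by simp))⟩
  have hE₀ : v ∈ E₀.domain := by
    refine ⟨hvV, ?_⟩
    rintro _ (rfl | rfl)
    · exact hd
    · exact Spv.le_mul _ ((v.on_res i hvV _ _).2 h) d
  obtain ⟨E, hvE, hED, hE, -⟩ := RationalDatum.exists_refines_le D E₀ v hv hE₀
  obtain ⟨q, hq⟩ : ∃ q, q * E₀.res E₀.b = E₀.res (ρ (D.b ^ n) * d) := by
    obtain ⟨u, hu⟩ := E₀.isUnit_res
    exact ⟨E₀.res (ρ (D.b ^ n) * d) * (u⁻¹ : _ˣ), by rw [← hu, mul_assoc, Units.inv_mul, mul_one]⟩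
  have hqE : q ∈ E₀.ring := Subring.subset_closure (Or.inr ⟨_, by simp [E₀], hq⟩)
  let κ := (Y.presheaf.map (homOfLE (locus_mono hE.1)).op).hom
  let lam := (Y.presheaf.map (homOfLE (locus_mono hED.1)).op).hom
  refine ⟨E, hED, κ q, hvE, ?_, ?_⟩
  · exact isIntegral_algebraMap (x := (⟨κ q, hE.2 hqE⟩ : E.ring))
  · change lam s * κ q = 1
    have comp : ∀ x : Γ(Y, f ⁻¹ᵁ D.W), κ (E₀.res (ρ x)) = lam (D.res x) := fun x => by
      refine (congrArg κ (map_map_apply Y _ _ x)).trans ((map_map_apply Y _ _ x).trans ?_)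
      exact (map_map_apply Y _ _ x).symm
    have e1 : lam (D.res (D.b ^ n)) * lam s = lam (D.res t) := by rw [← map_mul, hs]
    have e2 : κ q * (lam (D.res t) * κ (E₀.res d)) =
        lam (D.res (D.b ^ n)) * κ (E₀.res d) := by
      have := congrArg κ hq
      rw [map_mul] at this
      rw [← comp, ← comp]
      simpa only [E₀, map_mul] using this
    have u1 : IsUnit (lam (D.res t) * κ (E₀.res d)) := by
      rw [← comp, ← map_mul, ← map_mul]
      exact E₀.isUnit_res.map κ
    have u2 : IsUnit (κ (E₀.res d)) := isUnit_of_mul_isUnit_right u1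
    have u3 : IsUnit (lam (D.res (D.b ^ n))) := by
      rw [map_pow, map_pow]
      exact (D.isUnit_res.map lam).pow n
    refine (u3.mul u2).mul_left_cancel ?_
    linear_combination κ q * κ (E₀.res d) * e1 + e2

end

section

variable {Y X : Scheme.{u}} {f : Y ⟶ X}

/-- A rational domain as an open subset. -/
def RationalDatum.opens (D : RationalDatum f) : Opens (ValSpace f) := ⟨D.domain, D.isOpen_domain⟩

theorem RationalDatum.preimage_opens_le (D : RationalDatum f) :
    (Opens.map (sigmaHom f)).obj D.opens ≤ D.locus :=
  fun y hy => (D.sigma_mem_domain_iff y).1 hy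

/-- A germ of a section `s` of `𝒪` is invertible if `v(s) ≥ 1`. -/
theorem isUnit_germ (U : Opens (ValSpace f)) {v : ValSpace f} (hvU : v ∈ U) (s : valIntegers f U)
    (D : RationalDatum f) (hDU : D.domain ⊆ U) (hv : v ∈ D.domain)
    (n : ℕ) (t : Γ(Y, f ⁻¹ᵁ D.W))
    (hs : D.res (D.b ^ n) *
      Y.presheaf.map (homOfLE (D.locus_le_of_domain_subset hDU)).op s.1 = D.res t)
    (h : (v.on D.W hv.1).le (D.b ^ n) t) :
    IsUnit ((valPairRingedSpace f).integerPresheaf.germ U v hvU s) := by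
  obtain ⟨E, hED, r, hvE, hr, hsr⟩ := D.exists_inverse hv _ n t hs h
  have hrO : Y.presheaf.map (homOfLE E.preimage_opens_le).op r ∈ valIntegers f E.opens := by
    refine fun u hu => ⟨E, subset_rfl, hu, ?_⟩
    rw [RationalDatum.integral_res_iff]
    unfold RationalDatum.Integral
    have : Y.presheaf.map (homOfLE (le_refl E.locus)).op r = r :=
      congr($(Y.presheaf.map_id (op E.locus)) r)
    rwa [this]
  have i : E.opens ≤ U := fun u hu => hDU (hED.1 hu)
  refine .of_mul_eq_one ((valPairRingedSpace f).integerPresheaf.germ E.opens v hvE ⟨_, hrO⟩) ?_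
  have e1 : (valPairRingedSpace f).integerPresheaf.germ U v hvU s =
      (valPairRingedSpace f).integerPresheaf.germ E.opens v hvE
        ((valPairRingedSpace f).integerPresheaf.map (homOfLE i).op s) :=
    (TopCat.Presheaf.germ_res_apply (valPairRingedSpace f).integerPresheaf (homOfLE i) v hvE s).symm
  rw [e1]
  refine (map_mul _ _ _).symm.trans ((congrArg _ (Subtype.ext ?_)).trans (map_one _))
  have e2 := congrArg (Y.presheaf.map (homOfLE E.preimage_opens_le).op) hsr
  rw [map_mul, map_one] at e2
  refine Eq.trans ?_ e2
  refine congrArg (· * Y.presheaf.map (homOfLE E.preimage_opens_le).op r) ?_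
  refine Eq.trans ?_ (congrArg _ (map_map_apply Y _ _ s.1).symm)
  exact (map_map_apply Y _ _ s.1).symm

theorem exists_inverse_of_isUnit_germ (U : Opens (ValSpace f)) {v : ValSpace f} (hvU : v ∈ U)
    (s : valIntegers f U)
    (h : IsUnit ((valPairRingedSpace f).integerPresheaf.germ U v hvU s)) :
    ∃ (V : Opens (ValSpace f)) (i : V ≤ U) (r : valIntegers f V), v ∈ V ∧
      Y.presheaf.map (homOfLE ((Opens.map (sigmaHom f)).monotone i)).op s.1 * r.1 = 1 := by
  obtain ⟨r, hr⟩ := h.exists_right_inv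
  obtain ⟨V, hVU, hvV, r₀, rfl⟩ := TopCat.Presheaf.exists_le_germ_eq _ r (V := U) hvU
  let r : valIntegers f V := r₀
  let s₁ : valIntegers f V := ⟨_, (valPairRingedSpace f).res_mem hVU s.2⟩
  have e1 : (valPairRingedSpace f).integerPresheaf.germ V v hvV s₁ =
      (valPairRingedSpace f).integerPresheaf.germ U v hvU s :=
    TopCat.Presheaf.germ_res_apply (valPairRingedSpace f).integerPresheaf (homOfLE hVU) v hvV s
  have e2 : (valPairRingedSpace f).integerPresheaf.germ V v hvV (s₁ * r) =
      (valPairRingedSpace f).integerPresheaf.germ V v hvV 1 := by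
    refine (map_mul ((valPairRingedSpace f).integerPresheaf.germ V v hvV).hom s₁ r).trans ?_
    refine Eq.trans ?_ (hr.trans (map_one
      ((valPairRingedSpace f).integerPresheaf.germ V v hvV).hom).symm)
    exact congrArg (· * _) e1
  obtain ⟨W, hvW, i, j, e⟩ := TopCat.Presheaf.germ_eq _ _ _ _ _ _ e2
  refine ⟨W, i.le.trans hVU, ⟨_, (valPairRingedSpace f).res_mem i.le r.2⟩, hvW, ?_⟩
  have e3 : Y.presheaf.map (homOfLE ((Opens.map (sigmaHom f)).monotone i.le)).op (s₁.1 * r.1) =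
      Y.presheaf.map (homOfLE ((Opens.map (sigmaHom f)).monotone i.le)).op 1 :=
    congrArg Subtype.val e
  rw [map_mul, map_one] at e3
  refine Eq.trans (congrArg (· * _) ?_) e3
  exact (map_map_apply Y _ _ s.1).symm

variable [IsAffineHom f]

theorem isUnit_germ_of_one_le (U : Opens (ValSpace f)) {v : ValSpace f} (hvU : v ∈ U)
    (s : valIntegers f U) (D : RationalDatum f) (hDU : D.domain ⊆ U) (hv : v ∈ D.domain)
    (w : Valuation Γ(Y, D.locus) (v.on D.W hv.1).ValueGroup)
    (hw : ∀ a b, w (D.res a) ≤ w (D.res b) ↔ (v.on D.W hv.1).le a b)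
    (h : 1 ≤ w (Y.presheaf.map (homOfLE (D.locus_le_of_domain_subset hDU)).op s.1)) :
    IsUnit ((valPairRingedSpace f).integerPresheaf.germ U v hvU s) := by
  obtain ⟨n, t, hs⟩ := D.exists_fraction
    (Y.presheaf.map (homOfLE (D.locus_le_of_domain_subset hDU)).op s.1)
  refine isUnit_germ U hvU s D hDU hv n t hs ((hw _ _).1 ?_)
  rw [← hs, map_mul]
  exact le_mul_of_one_le_right zero_le h

theorem isLocalRing_stalk (v : ValSpace f) :
    IsLocalRing ((valPairRingedSpace f).integerPresheaf.stalk (v : (valM f).carrier)) := by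
  have : Nontrivial ((valPairRingedSpace f).integerPresheaf.stalk (v : (valM f).carrier)) := by
    by_contra hN
    rw [not_nontrivial_iff_subsingleton] at hN
    have h01 : (valPairRingedSpace f).integerPresheaf.germ ⊤ (v : (valM f).carrier) trivial 0 =
      (valPairRingedSpace f).integerPresheaf.germ ⊤ (v : (valM f).carrier) trivial 1 :=
        Subsingleton.elim _ _
    obtain ⟨U, hvU, i, j, e⟩ := TopCat.Presheaf.germ_eq _ _ _ _ _ _ h01
    rw [map_zero, map_one] at e
    have e' : (0 : Γ(Y, (Opens.map (sigmaHom f)).obj U)) = 1 := congrArg Subtype.val e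
    obtain ⟨D, hvD, hDU⟩ := RationalDatum.exists_mem_subset U v hvU
    obtain ⟨w, -, -⟩ := D.exists_valuation hvD
    have e2 := congrArg w (congrArg
      (Y.presheaf.map (homOfLE (D.locus_le_of_domain_subset hDU)).op) e')
    rw [map_zero, map_one, map_zero, map_one] at e2
    exact zero_ne_one e2
  refine .of_isUnit_or_isUnit_one_sub_self fun x => ?_
  obtain ⟨U, hvU, s₀, rfl⟩ := TopCat.Presheaf.exists_germ_eq _ x
  let s : valIntegers f U := s₀
  obtain ⟨D, hvD, hDU⟩ := RationalDatum.exists_mem_subset U v hvU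
  obtain ⟨w, hw, -⟩ := D.exists_valuation hvD
  let ρ := (Y.presheaf.map (homOfLE (D.locus_le_of_domain_subset hDU)).op).hom
  have h1 : (1 : (v.on D.W hvD.1).ValueGroup) ≤ max (w (ρ s.1)) (w (ρ (1 - s.1))) := by
    have := w.map_add (ρ s.1) (ρ (1 - s.1))
    rwa [← map_add, add_sub_cancel, map_one, map_one] at this
  rcases le_max_iff.1 h1 with h | h
  · exact Or.inl (isUnit_germ_of_one_le U hvU s D hDU hvD w hw h)
  · right
    have := isUnit_germ_of_one_le U hvU (1 - s) D hDU hvD w hw h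
    rw [← map_one ((valPairRingedSpace f).integerPresheaf.germ U v hvU).hom]
    exact (congrArg IsUnit
      (map_sub ((valPairRingedSpace f).integerPresheaf.germ U v hvU).hom 1 s)).mp this

end

section

variable {Y X Y' X' : Scheme.{u}} {f : Y ⟶ X} {f' : Y' ⟶ X'} [IsAffineHom f] [IsAffineHom f']
  (gY : Y ⟶ Y') (gX : X ⟶ X') (comm : gY ≫ f' = f ≫ gX)

theorem isLocalHom_stalkMap (v : ValSpace f) :
    IsLocalHom (PresheafedSpace.Hom.stalkMap (birPair gY gX comm).homO.hom v).hom := by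
  refine ⟨fun x hx => ?_⟩
  obtain ⟨U, hvU, s, rfl⟩ := TopCat.Presheaf.exists_germ_eq _ x
  change birFun gY gX comm v ∈ U at hvU
  -- the pull back `s'` of `s` is invertible near `v`
  set U' : Opens (ValSpace f) := (Opens.map (birHom gY gX comm)).obj U
  let s' : valIntegers f U' := ⟨_, (birPair gY gX comm).map_mem U s.1 s.2⟩
  have hx' : IsUnit ((valPairRingedSpace f).integerPresheaf.germ U' v hvU s') := by
    have := PresheafedSpace.stalkMap_germ_apply (birPair gY gX comm).homO.hom U v hvU s
    exact this ▸ hx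
  obtain ⟨V, hVU, r, hvV, hr⟩ := exists_inverse_of_isUnit_germ U' hvU s' hx'
  obtain ⟨D₂, hD₂V, hvD₂, hrD₂⟩ := r.2 v hvV
  obtain ⟨D, hvD, hDU⟩ := RationalDatum.exists_mem_subset U (birFun gY gX comm v) hvU
  obtain ⟨W, hW, hvW, hWD⟩ := exists_affine_le v.center (gX ⁻¹ᵁ D.W) hvD.1
  obtain ⟨F, hvF, hF₁, hF₂, hFW⟩ := RationalDatum.exists_refines_le (D.pull gY gX comm hW hWD) D₂ v
    ((D.mem_pull_iff gY gX comm hW hWD v).2 ⟨hvW, hvD⟩) hvD₂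
  have hFD : F.W ≤ gX ⁻¹ᵁ D.W := hFW.trans hWD
  have hle : F.locus ≤ gY ⁻¹ᵁ D.locus :=
    (RationalDatum.locus_mono hF₁.1).trans (D.pull_locus_le gY gX comm hW hWD)
  obtain ⟨w, hw, hw1⟩ := F.exists_valuation hvF
  have hFU : F.locus ≤ (Opens.map (sigmaHom f)).obj U' :=
    F.locus_le_of_domain_subset ((hF₂.1.trans hD₂V).trans hVU)
  have hFV : F.locus ≤ (Opens.map (sigmaHom f)).obj V :=
    F.locus_le_of_domain_subset (hF₂.1.trans hD₂V)
  -- `v(s') ≥ 1`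
  have h1 : 1 ≤ w (Y.presheaf.map (homOfLE hFU).op s'.1) := by
    have hr1 : w (Y.presheaf.map (homOfLE hFV).op r.1) ≤ 1 := hw1 _ (hrD₂.refine hF₂)
    have e := congrArg (fun z => w (Y.presheaf.map (homOfLE hFV).op z)) hr
    simp only [map_mul, map_one] at e
    rw [map_map_apply] at e
    rw [← e]
    exact mul_le_of_le_one_right zero_le hr1
  -- hence `h(v)(s) ≥ 1`
  obtain ⟨n, t, hs⟩ := D.exists_fraction
    (Y'.presheaf.map (homOfLE (D.locus_le_of_domain_subset hDU)).op s.1)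
  refine isUnit_germ U hvU s D hDU hvD n t hs ?_
  refine birFun_le_of_le gY gX comm hFD v hvF.1 hvD.1 ((hw _ _).1 ?_)
  have e1 : ∀ z, gY.appLE D.locus F.locus hle (D.res z) = F.res (pullSec gY gX comm hFD z) :=
    fun z => congr($((Scheme.Hom.map_appLE gY hle (homOfLE D.locus_le).op).trans
      (Scheme.Hom.appLE_map gY (le_preimage gY gX comm hFD) (homOfLE F.locus_le).op).symm) z)
  have e2 : gY.appLE D.locus F.locus hle
      (Y'.presheaf.map (homOfLE (D.locus_le_of_domain_subset hDU)).op s.1) =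
        Y.presheaf.map (homOfLE hFU).op s'.1 :=
    congr($((Scheme.Hom.map_appLE gY hle
      (homOfLE (D.locus_le_of_domain_subset hDU)).op).trans
      (Scheme.Hom.appLE_map gY (sigma_preimage_le gY gX comm U) (homOfLE hFU).op).symm) s.1)
  have e3 := congrArg (gY.appLE D.locus F.locus hle) hs
  rw [map_mul, e1, e1, e2] at e3
  rw [← e3, map_mul w]
  exact le_mul_of_one_le_right zero_le h1

end

/-! ### Pairs of schemes and the functor `bir` -/

/-- A pair of schemes: quasi-compact and quasi-separated schemes `Y`, `X` and an affine and
schematically dominant morphism `f : Y ⟶ X`. -/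
structure SchemePair where
  /-- The scheme `Y`. -/
  Y : Scheme.{u}
  /-- The scheme `X`. -/
  X : Scheme.{u}
  /-- The morphism `f`. -/
  f : Y ⟶ X
  [compactSpace_Y : CompactSpace Y]
  [quasiSeparatedSpace_Y : QuasiSeparatedSpace Y]
  [compactSpace_X : CompactSpace X]
  [quasiSeparatedSpace_X : QuasiSeparatedSpace X]
  [isAffineHom : IsAffineHom f]
  [isSchemeTheoreticallyDominant : IsSchemeTheoreticallyDominant f]

attribute [instance] SchemePair.compactSpace_Y SchemePair.quasiSeparatedSpace_Y
  SchemePair.compactSpace_X SchemePair.quasiSeparatedSpace_X SchemePair.isAffineHom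
  SchemePair.isSchemeTheoreticallyDominant

namespace SchemePair

/-- A morphism of pairs of schemes: a commutative square. -/
@[ext]
structure Hom (P Q : SchemePair.{u}) where
  /-- The morphism `Y ⟶ Y'`. -/
  gY : P.Y ⟶ Q.Y
  /-- The morphism `X ⟶ X'`. -/
  gX : P.X ⟶ Q.X
  comm : gY ≫ Q.f = P.f ≫ gX

/-- `X = Nor_Y X`: the canonical morphism from the relative normalization of `X` in `Y` to `X`
is an isomorphism. -/
def IsRelativelyNormal (P : SchemePair.{u}) : Prop := IsIso P.f.fromNormalization

/-- The birational space `Val(Y, X)` of a pair of schemes. -/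
noncomputable def bir (P : SchemePair.{u}) : LocallyPairRingedSpace.{u} where
  toPairRingedSpace := valPairRingedSpace P.f
  isLocalRing_stalk v := isLocalRing_stalk v

/-- The morphism of birational spaces induced by a morphism of pairs of schemes. -/
noncomputable def Hom.bir {P P' : SchemePair.{u}} (g : P.Hom P') :
    LocallyPairRingedSpace.Hom P.bir P'.bir where
  toHom := birPair g.gY g.gX g.comm
  isLocalHom_stalkMap v := isLocalHom_stalkMap g.gY g.gX g.comm v

end SchemePair

end BirationalSpaces

/-!
A morphism of pairs `(gY, gX) : (Y, X) ⟶ (Y', X')` can be read off from the morphism of birational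
spaces that it induces.

The map `Val(Y, X) → Val(Y', X')` lies over `gX` with respect to the maps sending a valuation to
its center. Every point `x` of `X` is the center of an unbounded valuation
(`ValSpace.center_surjective`): since `𝒪_X → f_* 𝒪_Y` is injective, the ring `(f_* 𝒪_Y)_x` is
nonzero, so there is a valuation ring of one of its residue fields which dominates the image of the
local ring `𝒪_{X, x}`, and the minimal primary specialization of the corresponding valuation is
unbounded and still has center `x`. Hence the map on valuation spaces determines `gX` as a map of
sets.

On the sheaves `ℳ = σ_* 𝒪_Y` the morphism of birational spaces is given by `gY`. For an affine open
`W` of `X'`, the affine open `f'⁻¹(W)` of `Y'` is the preimage under `σ` of the open set of the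
valuations with center in `W`. Therefore the effect of `gY` on the sections over `f'⁻¹(W)` is
determined, and these open sets cover `Y'` (`eq_of_birM_eq`).

Finally, `gX` is determined by `gY` together with its map of points, because a section of
`𝒪_X` is determined by its image in `f_* 𝒪_Y` (`eq_of_base_eq`).
-/

namespace BirationalSpaces

open CategoryTheory TopologicalSpace Opposite AlgebraicGeometry

/-- A local ring `A` mapping to a nonzero ring `B` is dominated by an unbounded valuation on `B`: take a
valuation ring of a residue field of `B` which dominates the image of the local ring, and pass to
the minimal primary specialization. This does not change the values of elements of `A` of
value `1`, and it does not increase values. -/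
theorem exists_val_lt_one_on_maximalIdeal {A B : Type*} [CommRing A] [IsLocalRing A] [CommRing B]
    [Nontrivial B] (φ : A →+* B) :
    ∃ v ∈ Val B φ.range, ∀ a ∈ IsLocalRing.maximalIdeal A, ¬ v.le 1 (φ a) := by
  obtain ⟨p, hp⟩ := Ideal.exists_maximal B
  have : p.IsPrime := hp.isPrime
  let ψ := (algebraMap B p.ResidueField).comp φ
  obtain ⟨V, hV, hloc⟩ := IsLocalRing.exists_factor_valuationRing ψ
  let w := V.valuation.comap (algebraMap B p.ResidueField)
  have hw : ∀ a, w (φ a) ≤ 1 := fun a => (V.valuation_le_one_iff _).2 (hV a)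
  refine ⟨(Spv.of w).retract, ⟨?_, Spv.not_isBounded_retract _⟩, fun a ha h => ?_⟩
  · rintro _ ⟨a, rfl⟩
    rw [Spv.retract_le_iff, Spv.of_le_iff, map_one]
    exact fun _ => hw a
  · -- An element of value at least `1` keeps its value under the specialization, so `a` would be a
    -- unit of the valuation ring, hence of `A`.
    have h1 := (Spv.retract_le_iff _ _ _).1 h ⟨1, by rw [mul_one]; exact Spv.le_rfl _ _⟩
    rw [Spv.of_le_iff, map_one] at h1
    have h2 : V.valuation (ψ a) = 1 := (hw a).antisymm h1
    have hu : IsUnit (ψ.codRestrict V.toSubring hV a) :=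
      (V.valuation_eq_one_iff ⟨ψ a, hV a⟩).2 h2
    exact ha (isUnit_of_map_unit _ a hu)

section

variable {Y X : Scheme.{u}} (f : Y ⟶ X)

theorem nontrivial_pushStalk [QuasiCompact f] [IsSchemeTheoreticallyDominant f] (x : X) :
    Nontrivial (pushStalk f x) := by
  by_contra hN
  rw [not_nontrivial_iff_subsingleton] at hN
  have h01 : (f.base _* Y.presheaf).germ ⊤ x trivial 0 =
    (f.base _* Y.presheaf).germ ⊤ x trivial 1 := Subsingleton.elim _ _
  obtain ⟨U, hxU, i, j, e⟩ := TopCat.Presheaf.germ_eq _ _ _ _ _ _ h01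
  rw [map_zero, map_one] at e
  have e' : f.app U 0 = f.app U 1 := by
    rw [map_zero, map_one]
    exact e
  have e2 := congrArg (X.presheaf.germ U x hxU) (f.app_injective U e')
  rw [map_zero, map_one] at e2
  exact zero_ne_one e2

/-- Every point of `X` is the center of a point of `Val(Y, X)`. -/
theorem ValSpace.center_surjective [QuasiCompact f] [IsSchemeTheoreticallyDominant f] :
    Function.Surjective (ValSpace.center (f := f)) := fun x => by
  have := nontrivial_pushStalk f x
  obtain ⟨v, hv, h⟩ := exists_val_lt_one_on_maximalIdeal (stalkToPushStalk f x)
  exact ⟨⟨x, v, hv, h⟩, rfl⟩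

/-- The open subset of the valuations whose center lies in `W`. -/
def centerOpens {W : X.Opens} (hW : IsAffineOpen W) : Opens (ValSpace f) :=
  ⟨ValSpace.basicSet W 1 1, ValSpace.isOpen_basicSet hW 1 1⟩

theorem sigma_preimage_centerOpens {W : X.Opens} (hW : IsAffineOpen W) :
    (Opens.map (sigmaHom f)).obj (centerOpens f hW) = f ⁻¹ᵁ W := by
  ext y
  refine (sigma_mem_basicSet_iff f W y 1 1).trans ?_
  rw [Scheme.basicOpen_of_isUnit _ isUnit_one]
  rfl

end

/-- Two morphisms of schemes agree if, locally on the source, they have a common affine open of the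
target through which they factor and the same effect on its sections. -/
theorem hom_ext_of_appLE {Y Z : Scheme.{u}} (g₁ g₂ : Y ⟶ Z) (h : ∀ y : Y, ∃ (U : Z.Opens)
    (_ : IsAffineOpen U) (V : Y.Opens) (h₁ : V ≤ g₁ ⁻¹ᵁ U) (h₂ : V ≤ g₂ ⁻¹ᵁ U),
    y ∈ V ∧ g₁.appLE U V h₁ = g₂.appLE U V h₂) : g₁ = g₂ := by
  refine Scheme.hom_ext_of_forall _ _ fun y => ?_
  obtain ⟨U, hU, V, h₁, h₂, hy, e⟩ := h y
  obtain ⟨W, hW, hyW, hWV⟩ := exists_affine_le y V hy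
  refine ⟨W, hyW, ?_⟩
  have e' : g₁.appLE U W (hWV.trans h₁) = g₂.appLE U W (hWV.trans h₂) := by
    rw [← Scheme.Hom.appLE_map g₁ h₁ (homOfLE hWV).op, e, Scheme.Hom.appLE_map]
  rw [← cancel_epi hW.isoSpec.inv, ← Category.assoc, ← Category.assoc]
  change hW.fromSpec ≫ g₁ = hW.fromSpec ≫ g₂
  rw [← hU.SpecMap_appLE_fromSpec g₁ hW (hWV.trans h₁),
    ← hU.SpecMap_appLE_fromSpec g₂ hW (hWV.trans h₂), e']

section

variable {Y X Y' X' : Scheme.{u}} {f : Y ⟶ X} {f' : Y' ⟶ X'}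

theorem base_eq_of_birFun_eq [QuasiCompact f] [IsSchemeTheoreticallyDominant f]
    {gY₁ gY₂ : Y ⟶ Y'} {gX₁ gX₂ : X ⟶ X'} {c₁ : gY₁ ≫ f' = f ≫ gX₁} {c₂ : gY₂ ≫ f' = f ≫ gX₂}
    (h : ∀ v, birFun gY₁ gX₁ c₁ v = birFun gY₂ gX₂ c₂ v) (x : X) : gX₁ x = gX₂ x := by
  obtain ⟨v, rfl⟩ := ValSpace.center_surjective f x
  exact congrArg ValSpace.center (h v)

/-- The comorphism of `birM`, compared over the preimage of `U` under the first of the two maps;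
the preimage under the second one is the same open set, but only propositionally. -/
theorem appLE_eq_of_birM_eq {gY₁ gY₂ : Y ⟶ Y'} {gX₁ gX₂ : X ⟶ X'} {c₁ : gY₁ ≫ f' = f ≫ gX₁}
    {c₂ : gY₂ ≫ f' = f ≫ gX₂} (h : birM gY₁ gX₁ c₁ = birM gY₂ gX₂ c₂) (U : Opens (ValSpace f')) :
    gY₁.appLE ((Opens.map (sigmaHom f')).obj U)
        ((Opens.map (sigmaHom f)).obj ((Opens.map (birHom gY₁ gX₁ c₁)).obj U))
        (sigma_preimage_le gY₁ gX₁ c₁ U) =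
      gY₂.appLE ((Opens.map (sigmaHom f')).obj U)
        ((Opens.map (sigmaHom f)).obj ((Opens.map (birHom gY₁ gX₁ c₁)).obj U))
        ((le_of_eq (by
          rw [show birHom gY₁ gX₁ c₁ = birHom gY₂ gX₂ c₂ from congrArg (fun m => m.hom.base) h])).trans
          (sigma_preimage_le gY₂ gX₂ c₂ U)) := by
  have e := PresheafedSpace.congr_app (congrArg (fun m => m.hom) h) (op U)
  refine e.trans ?_
  exact Scheme.Hom.appLE_map gY₂ (sigma_preimage_le gY₂ gX₂ c₂ U) _

theorem eq_of_birM_eq {gY₁ gY₂ : Y ⟶ Y'} {gX₁ gX₂ : X ⟶ X'} {c₁ : gY₁ ≫ f' = f ≫ gX₁}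
    {c₂ : gY₂ ≫ f' = f ≫ gX₂} (h : birM gY₁ gX₁ c₁ = birM gY₂ gX₂ c₂) [IsAffineHom f'] :
    gY₁ = gY₂ := by
  refine hom_ext_of_appLE _ _ fun y => ?_
  obtain ⟨W, hW, hyW, -⟩ := exists_affine_le (f' (gY₁ y)) ⊤ trivial
  have hs := sigma_preimage_centerOpens f' hW
  refine ⟨_, hs ▸ hW.preimage f', _, _, _, ?_,
    appLE_eq_of_birM_eq h (centerOpens f' hW)⟩
  change birFun gY₁ gX₁ c₁ (sigma f y) ∈ centerOpens f' hW
  rw [birFun_sigma]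
  exact hs.ge hyW

/-- The square determines `gX` on sections, since `𝒪_X → f_* 𝒪_Y` is injective. -/
theorem eq_of_base_eq [QuasiCompact f] [IsSchemeTheoreticallyDominant f] {gY : Y ⟶ Y'}
    {gX₁ gX₂ : X ⟶ X'} (c₁ : gY ≫ f' = f ≫ gX₁) (c₂ : gY ≫ f' = f ≫ gX₂)
    (h : ∀ x, gX₁ x = gX₂ x) : gX₁ = gX₂ := by
  refine hom_ext_of_appLE _ _ fun x => ?_
  obtain ⟨W, hW, hxW, -⟩ := exists_affine_le (gX₁ x) ⊤ trivial
  have h₂ : gX₁ ⁻¹ᵁ W ≤ gX₂ ⁻¹ᵁ W := fun z hz => by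
    change gX₂ z ∈ W
    rw [← h z]
    exact hz
  refine ⟨W, hW, gX₁ ⁻¹ᵁ W, le_rfl, h₂, hxW, ?_⟩
  ext a
  refine f.app_injective _ ?_
  have e : gX₁.appLE W (gX₁ ⁻¹ᵁ W) le_rfl ≫ f.app (gX₁ ⁻¹ᵁ W) =
      gX₂.appLE W (gX₁ ⁻¹ᵁ W) h₂ ≫ f.app (gX₁ ⁻¹ᵁ W) := by
    rw [Scheme.Hom.app_eq_appLE, Scheme.Hom.appLE_comp_appLE, Scheme.Hom.appLE_comp_appLE]
    simp only [← c₁, ← c₂]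
  exact congr($e a)

end

end BirationalSpaces

theorem mainTheorem3 (P P' : BirationalSpaces.SchemePair.{u})
    (hP : P.IsRelativelyNormal) (hP' : P'.IsRelativelyNormal)
    (g₁ g₂ : P.Hom P') (h : g₁.bir = g₂.bir) : g₁ = g₂ := by
  obtain ⟨gY₁, gX₁, c₁⟩ := g₁
  obtain ⟨gY₂, gX₂, c₂⟩ := g₂
  have hM : BirationalSpaces.birM gY₁ gX₁ c₁ = BirationalSpaces.birM gY₂ gX₂ c₂ :=
    congrArg (fun m => m.toHom.hom) h
  have hv : ∀ v, BirationalSpaces.birFun gY₁ gX₁ c₁ v = BirationalSpaces.birFun gY₂ gX₂ c₂ v :=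
    fun v => congrArg (fun m => m.hom.base v) hM
  have hX := BirationalSpaces.base_eq_of_birFun_eq hv
  obtain rfl := BirationalSpaces.eq_of_birM_eq hM
  obtain rfl := BirationalSpaces.eq_of_base_eq c₁ c₂ hX
  rfl
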